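/- Let $F$ be a field. Write $\mathrm{Br}(F)$ for its Brauer group (additively), and let the period of $\alpha\in\mathrm{Br}(F)$ be its order. Let $\mathrm{Nrd}(\alpha)\subseteq F^*$ be the group of reduced norms of nonzero elements of the central division $F$-algebra in the class $\alpha$. For a prime $\ell$ let $H^3(F,\mathbb{Q}_\ell/\mathbb{Z}_\ell(2))$ be the inductive limit of the Galois cohomology groups $H^3(F,\mu_{\ell^r}^{\otimes 2})$ if $\ell\neq\mathrm{char}(F)$, and of the groups $H^1(F,K_2(F_{sep})/\ell^r)$ (Milnor $K$-theory of a separable closure; Kato–Milne cohomology) if $\ell=\mathrm{char}(F)$; let $H^3(F,\mathbb{Q}/\mathbb{Z}(2))=\bigoplus_\ell H^3(F,\mathbb{Q}_\ell/\mathbb{Z}_\ell(2))$. The Rost kernel of $\alpha\in\mathrm{Br}(F)$ is $$\mathcal{R}(\alpha)=\{\lambda\in F^* : \alpha\cup(\lambda)=0\in H^3(F,\mathbb{Q}/\mathbb{Z}(2))\},$$ where the $\ell$-component of $\alpha\cup(\lambda)$ is the cup product with $(\lambda)$ of the $\ell$-primary component of $\alpha$. The Suslin group of $\alpha$ is the subgroup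 $\mathcal{S}(\alpha)$ of $F^*$ generated by $\bigcup_{i\ge 1}\mathrm{Nrd}(i\alpha)^i$, where $A^i$ denotes the set of $i$-th powers of elements of $A$. For a prime $\ell$ and $n\ge 1$, the field $F$ is called Rost $\ell^n$-divisible if every $\alpha\in\mathrm{Br}(F)$ whose period $\ell^k$ divides $\ell^n$ satisfies $\mathcal{R}(\alpha)=\prod_{i=0}^{k}\mathrm{Nrd}(\ell^i\alpha)^{\ell^i}$, the Rost kernel being computed in $H^3(F,\mathbb{Q}_\ell/\mathbb{Z}_\ell(2))$. It is called Rost divisible if it is Rost $\ell^n$-divisible for all primes $\ell$ and all $n\ge 1$. Let $N$ be a positive integer. If $F$ is Rost $\ell^n$-divisible for every prime power $\ell^n$ $(n\ge 1)$ that divides $N$, then $\mathcal{R}(\alpha)=\mathcal{S}(\alpha)$ for all $\alpha\in\mathrm{Br}(F)$ with $N\alpha=0$. Consequently, if $F$ is Rost divisible, then $\mathcal{R}(\alpha)=\mathcal{S}(\alpha)$ for all $\alpha\in\mathrm{Br}(F)$. -/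

import Mathlib

open scoped TensorProduct

theorem Brauer.repr_mul_tmul_one {K A B ι : Type*} [Field K] [Ring A] [Ring B] [Algebra K A]
    [Algebra K B] (b : Module.Basis ι K B) (x : A ⊗[K] B) (a : A) (i : ι) :
    (Algebra.TensorProduct.basis A b).repr (x * (a ⊗ₜ[K] 1)) i =
      (Algebra.TensorProduct.basis A b).repr x i * a := by
  induction x using TensorProduct.induction_on with
  | zero => simp
  | tmul c d => simp [Algebra.TensorProduct.basis_repr_tmul, mul_assoc,
      Algebra.commutes]
  | add x y hx hy => simp [add_mul, hx, hy]

theorem Brauer.tmul_one_mul {K A B : Type*} [Field K] [Ring A] [Ring B] [Algebra K A]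
    [Algebra K B] (x : A ⊗[K] B) (a : A) : (a ⊗ₜ[K] 1) * x = a • x := by
  induction x using TensorProduct.induction_on with
  | zero => simp
  | tmul c d => simp [TensorProduct.smul_tmul']
  | add x y hx hy => simp [mul_add, hx, hy]

instance Brauer.isSimpleRing_tensorProduct {K A B : Type*} [Field K] [Ring A] [Ring B]
    [Algebra K A] [Algebra K B] [Algebra.IsCentral K A] [IsSimpleRing A] [IsSimpleRing B] :
    IsSimpleRing (A ⊗[K] B) := by
  classical
  refine .of_eq_bot_or_eq_top fun I => ?_
  rw [or_iff_not_imp_left, ← I.one_mem_iff]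
  intro hI
  let b := Module.Basis.ofVectorSpace K B
  let β := Algebra.TensorProduct.basis A b
  -- a nonzero element of `I` with the fewest nonzero coordinates
  have hex : ∃ n : ℕ, ∃ x ∈ I, x ≠ 0 ∧ (β.repr x).support.card = n := by
    obtain ⟨x, hx1, hx2⟩ := SetLike.exists_of_lt (bot_lt_iff_ne_bot.mpr hI : ⊥ < I)
    exact ⟨_, x, hx1, hx2, rfl⟩
  obtain ⟨x, hxI, hx0, hxn⟩ := Nat.find_spec hex
  have hmin : ∀ y ∈ I, (β.repr y).support ⊂ (β.repr x).support → y = 0 := by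
    intro y hy hs
    by_contra hy0
    exact Nat.find_min hex (hxn ▸ Finset.card_lt_card hs) ⟨y, hy, hy0, rfl⟩
  have hr0 : β.repr x ≠ 0 := by simpa using hx0
  obtain ⟨j, hj⟩ := Finsupp.ne_iff.1 hr0
  rw [Finsupp.zero_apply] at hj
  let J : TwoSidedIdeal A := .mk' {a | ∃ y ∈ I, (β.repr y).support ⊆ (β.repr x).support ∧
      β.repr y j = a} ⟨0, I.zero_mem, by simp, by simp⟩
    (by
      rintro _ _ ⟨y, hy, hys, rfl⟩ ⟨z, hz, hzs, rfl⟩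
      refine ⟨y + z, I.add_mem hy hz, ?_, by simp⟩
      rw [map_add]
      exact Finsupp.support_add.trans (Finset.union_subset hys hzs))
    (by
      rintro _ ⟨y, hy, hys, rfl⟩
      exact ⟨-y, I.neg_mem hy, by simpa using hys, by simp⟩)
    (by
      rintro a _ ⟨y, hy, hys, rfl⟩
      refine ⟨(a ⊗ₜ[K] 1) * y, I.mul_mem_left _ _ hy, ?_, ?_⟩
      · rw [Brauer.tmul_one_mul, map_smul]
        exact Finsupp.support_smul.trans hys
      · rw [Brauer.tmul_one_mul, map_smul]; simp)
    (by
      rintro _ a ⟨y, hy, hys, rfl⟩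
      refine ⟨y * (a ⊗ₜ[K] 1), I.mul_mem_right _ _ hy, ?_, ?_⟩
      · intro i hi
        apply hys
        rw [Finsupp.mem_support_iff] at hi ⊢
        intro h
        exact hi (by rw [Brauer.repr_mul_tmul_one, h, zero_mul])
      · rw [Brauer.repr_mul_tmul_one])
  have hJ : (1 : A) ∈ J := by
    refine IsSimpleRing.one_mem_of_ne_zero_mem J hj ?_
    rw [TwoSidedIdeal.mem_mk']
    exact ⟨x, hxI, subset_rfl, rfl⟩
  rw [TwoSidedIdeal.mem_mk'] at hJ
  obtain ⟨y, hyI, hys, hyj⟩ := hJ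
  have hy0 : y ≠ 0 := by rintro rfl; simp at hyj
  have hcomm : ∀ (a : A) (i), a * β.repr y i = β.repr y i * a := by
    intro a i
    have hz : (a ⊗ₜ[K] 1) * y - y * (a ⊗ₜ[K] 1) = 0 := by
      apply hmin _ (I.sub_mem (I.mul_mem_left _ _ hyI) (I.mul_mem_right _ _ hyI))
      have key : ∀ i, β.repr ((a ⊗ₜ[K] 1) * y - y * (a ⊗ₜ[K] 1)) i =
          a * β.repr y i - β.repr y i * a := by
        intro i
        rw [map_sub, Finsupp.sub_apply, Brauer.repr_mul_tmul_one, Brauer.tmul_one_mul, map_smul]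
        rfl
      refine (Finset.ssubset_iff_of_subset ?_).2 ⟨j, by simpa using hj, ?_⟩
      · intro i hi
        apply hys
        rw [Finsupp.mem_support_iff] at hi ⊢
        intro h
        exact hi (by rw [key, h]; simp)
      · rw [Finsupp.mem_support_iff, key, hyj]; simp
    have := congrArg (fun z => β.repr z i) hz
    simp only [map_sub, Finsupp.sub_apply, map_zero, Finsupp.zero_apply] at this
    rw [Brauer.repr_mul_tmul_one, Brauer.tmul_one_mul, map_smul] at this
    simpa [sub_eq_zero] using this
  have hcen : ∀ i, ∃ k : K, β.repr y i = algebraMap K A k := fun i =>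
    (Algebra.IsCentral.mem_center_iff K).1 (Subalgebra.mem_center_iff.2 fun a => hcomm a i)
  have hyB : ∃ d : B, y = 1 ⊗ₜ[K] d := by
    choose k hk using hcen
    refine ⟨∑ i ∈ (β.repr y).support, k i • b i, ?_⟩
    conv_lhs => rw [← β.linearCombination_repr y]
    rw [Finsupp.linearCombination_apply, Finsupp.sum, TensorProduct.tmul_sum]
    refine Finset.sum_congr rfl fun i _ => ?_
    rw [hk, algebraMap_smul, TensorProduct.tmul_smul]
    simp [β]
  obtain ⟨d, rfl⟩ := hyB
  have hd : d ≠ 0 := by rintro rfl; simp at hy0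
  have h1 : (1 : B) ∈ I.comap (Algebra.TensorProduct.includeRight : B →ₐ[K] A ⊗[K] B) :=
    IsSimpleRing.one_mem_of_ne_zero_mem _ hd (by simpa [TwoSidedIdeal.mem_comap] using hyI)
  simpa [TwoSidedIdeal.mem_comap, Algebra.TensorProduct.one_def] using h1

instance Brauer.isCentral_tensorProduct {K A B : Type*} [Field K] [Ring A] [Ring B]
    [Algebra K A] [Algebra K B] [Algebra.IsCentral K A] [Algebra.IsCentral K B] :
    Algebra.IsCentral K (A ⊗[K] B) where
  out := by
    intro z hz
    rw [Subalgebra.mem_center_iff] at hz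
    have h1 : z ∈ Subalgebra.centralizer K
        ((Algebra.TensorProduct.includeLeft : A →ₐ[K] A ⊗[K] B).range : Set (A ⊗[K] B)) := by
      rw [Subalgebra.mem_centralizer_iff]
      exact fun g _ => hz g
    rw [Subalgebra.centralizer_coe_range_includeLeft_eq_center_tensorProduct] at h1
    obtain ⟨w, rfl⟩ := h1
    have h2 : ∃ d : B, Algebra.TensorProduct.map (Subalgebra.center K A).val (AlgHom.id K B) w =
        1 ⊗ₜ[K] d := by
      clear hz
      induction w using TensorProduct.induction_on with
      | zero => exact ⟨0, by simp⟩
      | tmul c d =>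
        obtain ⟨k, hk⟩ := (Algebra.IsCentral.mem_center_iff K).1 c.2
        refine ⟨k • d, ?_⟩
        simp [hk, Algebra.algebraMap_eq_smul_one, TensorProduct.smul_tmul]
      | add x y hx hy =>
        obtain ⟨d, hd⟩ := hx
        obtain ⟨e, he⟩ := hy
        exact ⟨d + e, by rw [map_add, hd, he, TensorProduct.tmul_add]⟩
    obtain ⟨d, hd⟩ := h2
    rcases subsingleton_or_nontrivial A with hA | hA
    · have : Subsingleton (A ⊗[K] B) := by
        refine subsingleton_of_zero_eq_one ?_
        rw [Algebra.TensorProduct.one_def, Subsingleton.elim (1 : A) 0, TensorProduct.zero_tmul]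
      rw [Subsingleton.elim (AlgHom.toRingHom _ w) (0 : A ⊗[K] B)]
      exact zero_mem _
    have hinj : Function.Injective (Algebra.TensorProduct.includeRight : B →ₐ[K] A ⊗[K] B) :=
      Algebra.TensorProduct.includeRight_injective (FaithfulSMul.algebraMap_injective K A)
    have h3 : d ∈ Subalgebra.center K B := by
      rw [Subalgebra.mem_center_iff]
      intro e
      apply hinj
      have := hz (1 ⊗ₜ[K] e)
      have hd' : (Algebra.TensorProduct.map (Subalgebra.center K A).val (AlgHom.id K B)).toRingHom w =
        1 ⊗ₜ[K] d := hd
      rw [hd'] at this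
      simpa using this
    obtain ⟨k, hk⟩ := (Algebra.IsCentral.mem_center_iff K).1 h3
    refine Algebra.mem_bot.2 ⟨k, ?_⟩
    refine Eq.trans ?_ hd.symm
    rw [hk, Algebra.TensorProduct.algebraMap_apply, Algebra.algebraMap_eq_smul_one,
      Algebra.algebraMap_eq_smul_one, TensorProduct.smul_tmul]

universe u

namespace Brauer

variable {F : Type u} [Field F]

/-- The tensor product of two central simple algebras. -/
noncomputable def CSA.tensor (A B : CSA.{u, u} F) : CSA.{u, u} F where
  __ := AlgCat.of F (A ⊗[F] B)
  isCentral := inferInstanceAs (Algebra.IsCentral F (A ⊗[F] B))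
  isSimple := inferInstanceAs (IsSimpleRing (A ⊗[F] B))
  fin_dim := inferInstanceAs (FiniteDimensional F (A ⊗[F] B))

/-- The opposite of a central simple algebra. -/
noncomputable def CSA.opposite (A : CSA.{u, u} F) : CSA.{u, u} F where
  __ := AlgCat.of F Aᵐᵒᵖ
  isCentral := inferInstanceAs (Algebra.IsCentral F Aᵐᵒᵖ)
  isSimple := inferInstanceAs (IsSimpleRing Aᵐᵒᵖ)
  fin_dim := inferInstanceAs (FiniteDimensional F Aᵐᵒᵖ)

/-- The base field as a central simple algebra over itself. -/
noncomputable def CSA.base (F : Type u) [Field F] : CSA.{u, u} F where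
  __ := AlgCat.of F F
  isCentral := inferInstanceAs (Algebra.IsCentral F F)
  isSimple := inferInstanceAs (IsSimpleRing F)
  fin_dim := inferInstanceAs (FiniteDimensional F F)

theorem equivalent_of_algEquiv {A B : CSA.{u, u} F} (e : A ≃ₐ[F] B) : IsBrauerEquivalent A B :=
  ⟨1, 1, one_ne_zero, one_ne_zero, ⟨e.mapMatrix⟩⟩

theorem equivalent_base_of_algEquiv {A : CSA.{u, u} F} {n : ℕ} (hn : n ≠ 0)
    (e : A ≃ₐ[F] Matrix (Fin n) (Fin n) F) : IsBrauerEquivalent A (CSA.base F) :=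
  ⟨1, n, one_ne_zero, hn, ⟨(Matrix.reindexAlgEquiv F A finOneEquiv).trans <|
    Matrix.uniqueAlgEquiv.trans e⟩⟩

theorem equivalent_tensor {A A' B B' : CSA.{u, u} F} (h : IsBrauerEquivalent A A')
    (h' : IsBrauerEquivalent B B') : IsBrauerEquivalent (CSA.tensor A B) (CSA.tensor A' B') := by
  obtain ⟨n, m, hn, hm, ⟨e⟩⟩ := h
  obtain ⟨p, q, hp, hq, ⟨e'⟩⟩ := h'
  refine ⟨n * p, m * q, mul_ne_zero hn hp, mul_ne_zero hm hq, ⟨?_⟩⟩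
  exact (Matrix.reindexAlgEquiv F (A ⊗[F] B) finProdFinEquiv).symm.trans <|
    (Matrix.kroneckerTMulAlgEquiv (Fin n) (Fin p) F F A B).symm.trans <|
    (Algebra.TensorProduct.congr e e').trans <|
    (Matrix.kroneckerTMulAlgEquiv (Fin m) (Fin q) F F A' B').trans <|
    Matrix.reindexAlgEquiv F (A' ⊗[F] B') finProdFinEquiv

theorem equivalent_opposite {A A' : CSA.{u, u} F} (h : IsBrauerEquivalent A A') :
    IsBrauerEquivalent (CSA.opposite A) (CSA.opposite A') := by
  obtain ⟨n, m, hn, hm, ⟨e⟩⟩ := h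
  exact ⟨n, m, hn, hm, ⟨(AlgEquiv.mopMatrix (R := F) (α := A) (m := Fin n)).trans <|
    (AlgEquiv.op e).trans (AlgEquiv.mopMatrix (R := F) (α := A') (m := Fin m)).symm⟩⟩

theorem opposite_tensor_equivalent (A : CSA.{u, u} F) :
    IsBrauerEquivalent (CSA.tensor (CSA.opposite A) A) (CSA.base F) := by
  have hinj : Function.Injective (AlgHom.mulLeftRight F A) :=
    RingHom.injective (AlgHom.mulLeftRight F A).toRingHom
  have hdim : Module.finrank F (A ⊗[F] Aᵐᵒᵖ) = Module.finrank F (Module.End F A) := by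
    rw [Module.finrank_tensorProduct, Module.finrank_linearMap,
      (MulOpposite.opLinearEquiv F (M := A)).symm.finrank_eq]
  have hbij : Function.Bijective (AlgHom.mulLeftRight F A) :=
    ⟨hinj, (LinearMap.injective_iff_surjective_of_finrank_eq_finrank hdim
      (f := (AlgHom.mulLeftRight F A).toLinearMap)).1 hinj⟩
  exact equivalent_base_of_algEquiv (A := CSA.tensor (CSA.opposite A) A)
    (Module.finrank_pos (R := F) (M := A)).ne'
    ((Algebra.TensorProduct.comm F Aᵐᵒᵖ A).trans <| (AlgEquiv.ofBijective _ hbij).trans <|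
      algEquivMatrix (Module.finBasis F A))

end Brauer

/-- The Brauer group of a field, written additively: classes of central simple algebras with the
tensor product as addition. -/
def Br (F : Type u) [Field F] : Type (u + 1) := BrauerGroup.{u, u} F

namespace Br

open Brauer

variable {F : Type u} [Field F]

/-- The Brauer class of a central simple algebra. -/
def mk (A : CSA.{u, u} F) : Br F := Quotient.mk (Brauer.CSA_Setoid F) A

theorem mk_eq_mk {A B : CSA.{u, u} F} : mk A = mk B ↔ IsBrauerEquivalent A B :=
  ⟨fun h => Quotient.exact h, fun h => Quotient.sound h⟩

theorem mk_surjective : Function.Surjective (mk (F := F)) := fun α => Quotient.exists_rep α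

noncomputable instance : Add (Br F) :=
  ⟨Quotient.map₂ CSA.tensor fun _ _ h _ _ h' => equivalent_tensor h h'⟩

noncomputable instance : Zero (Br F) := ⟨mk (CSA.base F)⟩

noncomputable instance : Neg (Br F) :=
  ⟨Quotient.map CSA.opposite fun _ _ h => equivalent_opposite h⟩

noncomputable instance : AddCommGroup (Br F) where
  add_assoc := by
    rintro ⟨A⟩ ⟨B⟩ ⟨C⟩
    exact mk_eq_mk.2 (equivalent_of_algEquiv (Algebra.TensorProduct.assoc F F F A B C))
  zero_add := by
    rintro ⟨A⟩
    exact mk_eq_mk.2 (equivalent_of_algEquiv (A := CSA.tensor (CSA.base F) A)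
      (Algebra.TensorProduct.lid F A))
  add_zero := by
    rintro ⟨A⟩
    exact mk_eq_mk.2 (equivalent_of_algEquiv (A := CSA.tensor A (CSA.base F))
      (Algebra.TensorProduct.rid F F A))
  nsmul := nsmulRec
  zsmul := zsmulRec
  neg_add_cancel := by
    rintro ⟨A⟩
    exact mk_eq_mk.2 (opposite_tensor_equivalent A)
  add_comm := by
    rintro ⟨A⟩ ⟨B⟩
    exact mk_eq_mk.2 (equivalent_of_algEquiv (A := CSA.tensor A B) (B := CSA.tensor B A)
      (Algebra.TensorProduct.comm F A B))

theorem mk_add_mk (A B : CSA.{u, u} F) : mk A + mk B = mk (CSA.tensor A B) := rfl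

theorem zero_def : (0 : Br F) = mk (CSA.base F) := rfl

end Br

namespace DiscreteCohomology

variable {G M M' : Type*} [Group G] [AddCommGroup M] [AddCommGroup M']
  {k : Type*} [CommRing k] [Module k M] [Module k M']

/-- The differential of inhomogeneous cochains. -/
def d (ρ : Representation k G M) (n : ℕ) : ((Fin n → G) → M) →+ ((Fin (n + 1) → G) → M) where
  toFun f g := ρ (g 0) (f fun i => g i.succ) +
    ∑ j : Fin (n + 1), (-1 : k) ^ ((j : ℕ) + 1) • f (Fin.contractNth j (· * ·) g)
  map_zero' := by ext; simp
  map_add' f g := by ext; simp [Finset.sum_add_distrib, add_add_add_comm]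

theorem d_one (ρ : Representation k G M) (f : (Fin 1 → G) → M) (g : Fin 2 → G) :
    d ρ 1 f g = ρ (g 0) (f ![g 1]) - f ![g 0 * g 1] + f ![g 0] := by
  have h0 : (fun i : Fin 1 => g i.succ) = ![g 1] := by funext i; fin_cases i; rfl
  have h1 : Fin.contractNth 0 (· * ·) g = ![g 0 * g 1] := by funext i; fin_cases i; rfl
  have h2 : Fin.contractNth 1 (· * ·) g = ![g 0] := by funext i; fin_cases i; rfl
  change ρ (g 0) (f fun i => g i.succ) +
    ∑ j : Fin 2, (-1 : k) ^ ((j : ℕ) + 1) • f (Fin.contractNth j (· * ·) g) = _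
  rw [Fin.sum_univ_two, h0, h1, h2]
  simp
  abel

theorem d_two (ρ : Representation k G M) (f : (Fin 2 → G) → M) (g : Fin 3 → G) :
    d ρ 2 f g = ρ (g 0) (f ![g 1, g 2]) - f ![g 0 * g 1, g 2] + f ![g 0, g 1 * g 2] -
      f ![g 0, g 1] := by
  have h0 : (fun i : Fin 2 => g i.succ) = ![g 1, g 2] := by funext i; fin_cases i <;> rfl
  have h1 : Fin.contractNth 0 (· * ·) g = ![g 0 * g 1, g 2] := by funext i; fin_cases i <;> rfl
  have h2 : Fin.contractNth 1 (· * ·) g = ![g 0, g 1 * g 2] := by funext i; fin_cases i <;> rfl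
  have h3 : Fin.contractNth 2 (· * ·) g = ![g 0, g 1] := by funext i; fin_cases i <;> rfl
  change ρ (g 0) (f fun i => g i.succ) +
    ∑ j : Fin 3, (-1 : k) ^ ((j : ℕ) + 1) • f (Fin.contractNth j (· * ·) g) = _
  rw [Fin.sum_univ_three, h0, h1, h2, h3]
  simp [pow_succ]
  abel

theorem d_three (ρ : Representation k G M) (f : (Fin 3 → G) → M) (g : Fin 4 → G) :
    d ρ 3 f g = ρ (g 0) (f ![g 1, g 2, g 3]) - f ![g 0 * g 1, g 2, g 3] +
      f ![g 0, g 1 * g 2, g 3] - f ![g 0, g 1, g 2 * g 3] + f ![g 0, g 1, g 2] := by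
  have h0 : (fun i : Fin 3 => g i.succ) = ![g 1, g 2, g 3] := by funext i; fin_cases i <;> rfl
  have h1 : Fin.contractNth 0 (· * ·) g = ![g 0 * g 1, g 2, g 3] := by
    funext i; fin_cases i <;> rfl
  have h2 : Fin.contractNth 1 (· * ·) g = ![g 0, g 1 * g 2, g 3] := by
    funext i; fin_cases i <;> rfl
  have h3 : Fin.contractNth 2 (· * ·) g = ![g 0, g 1, g 2 * g 3] := by
    funext i; fin_cases i <;> rfl
  have h4 : Fin.contractNth 3 (· * ·) g = ![g 0, g 1, g 2] := by funext i; fin_cases i <;> rfl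
  change ρ (g 0) (f fun i => g i.succ) +
    ∑ j : Fin 4, (-1 : k) ^ ((j : ℕ) + 1) • f (Fin.contractNth j (· * ·) g) = _
  rw [Fin.sum_univ_four, h0, h1, h2, h3, h4]
  simp [pow_succ]
  abel

variable [TopologicalSpace G]

variable (G M) in
/-- The continuous cochains with values in the discrete group `M`. -/
def cochains (n : ℕ) : AddSubgroup ((Fin n → G) → M) where
  carrier := {f | IsLocallyConstant f}
  zero_mem' := IsLocallyConstant.const 0
  add_mem' hf hg := IsLocallyConstant.add hf hg
  neg_mem' hf := IsLocallyConstant.neg hf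

/-- The continuous cocycles. -/
def cocycles (ρ : Representation k G M) (n : ℕ) : AddSubgroup ((Fin n → G) → M) :=
  cochains G M n ⊓ (d ρ n).ker

/-- The coboundaries of continuous cochains. -/
def coboundaries (ρ : Representation k G M) : (n : ℕ) → AddSubgroup ((Fin n → G) → M)
  | 0 => ⊥
  | n + 1 => (cochains G M n).map (d ρ n)

/-- The cohomology group `Hⁿ(G, M)` of a discrete `G`-module `M`. -/
def H (ρ : Representation k G M) (n : ℕ) : Type _ :=
  cocycles ρ n ⧸ (coboundaries ρ n).addSubgroupOf (cocycles ρ n)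

instance (ρ : Representation k G M) (n : ℕ) : AddCommGroup (H ρ n) :=
  inferInstanceAs (AddCommGroup (cocycles ρ n ⧸ (coboundaries ρ n).addSubgroupOf (cocycles ρ n)))

/-- The cohomology class of a cocycle. -/
def H.mk (ρ : Representation k G M) (n : ℕ) : cocycles ρ n →+ H ρ n :=
  QuotientAddGroup.mk' _

/-- The action of `G` on `M` is continuous for the discrete topology of `M`. -/
def IsDiscrete (ρ : Representation k G M) : Prop :=
  ∀ m : M, IsLocallyConstant fun g : G => ρ g m

theorem IsDiscrete.apply {ρ : Representation k G M} (hρ : IsDiscrete ρ) {X : Type*}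
    [TopologicalSpace X] {γ : X → G} (hγ : Continuous γ) {f : X → M} (hf : IsLocallyConstant f) :
    IsLocallyConstant fun x => ρ (γ x) (f x) := by
  rw [IsLocallyConstant.iff_eventually_eq]
  intro x
  filter_upwards [hf.eventually_eq x, ((hρ (f x)).comp_continuous hγ).eventually_eq x] with y h1 h2
  rw [h1]
  exact h2

/-- The cup product of a `2`-cocycle and a `1`-cocycle. -/
def cup [IsTopologicalGroup G] {ρ : Representation k G M} {ρ' : Representation k G M'}
    (hρ' : IsDiscrete ρ') (c : cocycles ρ 2) (χ : cocycles ρ' 1) : cocycles (ρ.tprod ρ') 3 where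
  val g := c.1 ![g 0, g 1] ⊗ₜ[k] ρ' (g 0 * g 1) (χ.1 ![g 2])
  property := by
    refine ⟨?_, ?_⟩
    · exact IsLocallyConstant.comp₂ (c.2.1.comp_continuous (by fun_prop))
        (hρ'.apply (by fun_prop) (χ.2.1.comp_continuous (by fun_prop))) _
    · refine AddMonoidHom.mem_ker.2 (funext fun g => ?_)
      have hc := congrFun c.2.2 ![g 0, g 1, g 2]
      rw [d_two] at hc
      have hχ := congrFun χ.2.2 ![g 2, g 3]
      rw [d_one] at hχ
      simp only [Matrix.cons_val_zero, Matrix.cons_val_one, Matrix.cons_val, Pi.zero_apply]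
        at hc hχ
      have hχ' : χ.1 ![g 2 * g 3] = ρ' (g 2) (χ.1 ![g 3]) + χ.1 ![g 2] := by
        rw [← sub_eq_zero, ← neg_eq_zero, ← hχ]; abel
      rw [d_three]
      simp only [Matrix.cons_val_zero, Matrix.cons_val_one, Matrix.cons_val, Pi.zero_apply,
        Representation.tprod_apply, TensorProduct.map_tmul, hχ', map_add, TensorProduct.tmul_add]
      have e1 : ρ' (g 0) (ρ' (g 1 * g 2) (χ.1 ![g 3])) = ρ' (g 0 * g 1 * g 2) (χ.1 ![g 3]) := by
        rw [mul_assoc, map_mul ρ' (g 0)]; rfl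
      have e2 : ρ' (g 0 * g 1) (ρ' (g 2) (χ.1 ![g 3])) = ρ' (g 0 * g 1 * g 2) (χ.1 ![g 3]) := by
        rw [map_mul ρ' (g 0 * g 1)]; rfl
      rw [e1, e2, ← mul_assoc]
      have := congrArg (fun m => m ⊗ₜ[k] ρ' (g 0 * g 1 * g 2) (χ.1 ![g 3])) hc
      simp only [TensorProduct.add_tmul, TensorProduct.sub_tmul, TensorProduct.zero_tmul] at this
      rw [← this]
      abel

end DiscreteCohomology

namespace GaloisModule

open DiscreteCohomology

section

variable (F L : Type*) [Field F] [Field L] [Algebra F L]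

/-- The Galois module `Lˣ`, written additively. -/
noncomputable def unitsRep : Representation ℤ Gal(L/F) (Additive Lˣ) :=
  Representation.ofMulDistribMulAction Gal(L/F) Lˣ

/-- The Galois module `μ_m` of `m`-th roots of unity in `L`, written additively. -/
noncomputable def muRep (m : ℕ) : Representation ℤ Gal(L/F) (Additive (rootsOfUnity m L)) where
  toFun σ := (MonoidHom.toAdditive (restrictRootsOfUnity σ m)).toIntLinearMap
  map_one' := rfl
  map_mul' _ _ := rfl

/-- The inclusion of `μ_m` into `Lˣ`. -/
noncomputable def muIncl (m : ℕ) : Additive (rootsOfUnity m L) →+ Additive Lˣ :=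
  MonoidHom.toAdditive (rootsOfUnity m L).subtype

/-- The relations that define `K₂(L)/m` as a quotient of `Lˣ ⊗ Lˣ`: the Steinberg relations
`{a, b} = 0` for `a + b = 1`, and the multiples of `m`. -/
def milnorRelations (m : ℕ) : AddSubgroup (Additive Lˣ ⊗[ℤ] Additive Lˣ) :=
  AddSubgroup.closure
    ({t | ∃ a b : Lˣ, (a : L) + b = 1 ∧ t = Additive.ofMul a ⊗ₜ[ℤ] Additive.ofMul b} ∪
      {t | ∃ s, t = m • s})

/-- Milnor's `K₂(L)` modulo `m`. -/
abbrev MilnorK2Mod (m : ℕ) : Type _ := (Additive Lˣ ⊗[ℤ] Additive Lˣ) ⧸ milnorRelations L m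

/-- The symbol `{a, b}` in `K₂(L)/m`. -/
def milnorSymbol (m : ℕ) (a b : Lˣ) : MilnorK2Mod L m :=
  QuotientAddGroup.mk' (milnorRelations L m) (Additive.ofMul a ⊗ₜ[ℤ] Additive.ofMul b)

theorem milnorRelations_le_comap (m : ℕ) (σ : Gal(L/F)) :
    milnorRelations L m ≤ (milnorRelations L m).comap
      ((unitsRep F L).tprod (unitsRep F L) σ).toAddMonoidHom := by
  refine (AddSubgroup.closure_le _).2 ?_
  rintro _ (⟨a, b, h, rfl⟩ | ⟨s, rfl⟩)
  · refine AddSubgroup.subset_closure (Or.inl ⟨σ • a, σ • b, ?_, rfl⟩)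
    have := congrArg σ h
    rwa [map_add, map_one] at this
  · exact AddSubgroup.subset_closure (Or.inr ⟨_, map_nsmul _ _ _⟩)

/-- The Galois module `K₂(L)/m`, with `σ{a, b} = {σa, σb}`. -/
noncomputable def milnorRep (m : ℕ) : Representation ℤ Gal(L/F) (MilnorK2Mod L m) where
  toFun σ := (QuotientAddGroup.map _ _ ((unitsRep F L).tprod (unitsRep F L) σ).toAddMonoidHom
    (milnorRelations_le_comap F L m σ)).toIntLinearMap
  map_one' := by
    ext x
    obtain ⟨t, rfl⟩ := QuotientAddGroup.mk_surjective x
    change QuotientAddGroup.mk ((unitsRep F L).tprod (unitsRep F L) 1 t) = _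
    rw [map_one]
    rfl
  map_mul' σ τ := by
    ext x
    obtain ⟨t, rfl⟩ := QuotientAddGroup.mk_surjective x
    change QuotientAddGroup.mk ((unitsRep F L).tprod (unitsRep F L) (σ * τ) t) = _
    rw [map_mul]
    rfl

end

variable {F L : Type*} [Field F] [Field L] [Algebra F L]

/-- An element of `Fˣ` seen in `Lˣ`. -/
def toTop (a : Fˣ) : Lˣ := Units.map (algebraMap F L).toMonoidHom a

theorem smul_toTop (σ : Gal(L/F)) (a : Fˣ) : σ • (toTop a : Lˣ) = toTop a :=
  Units.ext (σ.commutes a)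

theorem isLocallyConstant_apply [Algebra.IsIntegral F L] (x : L) :
    IsLocallyConstant fun σ : Gal(L/F) => σ x := by
  rw [IsLocallyConstant.iff_eventually_eq]
  intro σ
  have h := stabilizer_isOpen_of_isIntegral (K := F) (L := L) x
  have h1 : (MulAction.stabilizer Gal(L/F) x : Set Gal(L/F)) ∈ nhds (σ⁻¹ * σ) := by
    rw [inv_mul_cancel]
    exact h.mem_nhds (one_mem _)
  have h2 := (continuous_const_mul σ⁻¹).continuousAt.preimage_mem_nhds h1
  filter_upwards [h2] with τ hτ
  have hτ' : σ⁻¹ (τ x) = x := hτ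
  have := congrArg σ hτ'
  rwa [← AlgEquiv.mul_apply, mul_inv_cancel] at this

theorem isDiscrete_muRep [Algebra.IsIntegral F L] (m : ℕ) : IsDiscrete (muRep F L m) := by
  intro ζ
  refine IsLocallyConstant.desc _ (fun ξ : Additive (rootsOfUnity m L) => ((ξ.toMul : Lˣ) : L))
    (isLocallyConstant_apply ((ζ.toMul : Lˣ) : L)) fun a b h => ?_
  exact Additive.toMul.injective (Subtype.ext (Units.ext h))

/-- The Kummer cocycle `σ ↦ σ(x)/x` with values in `μ_m`, where `x` is an `m`-th root of `a`.
Its class is `(a) ∈ H¹(F, μ_m)`. -/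
noncomputable def kummerCocycle [Algebra.IsIntegral F L] {m : ℕ} {a : Fˣ} (x : Lˣ)
    (hx : x ^ m = toTop a) : cocycles (muRep F L m) 1 where
  val g := Additive.ofMul ⟨g 0 • x / x, by
    rw [mem_rootsOfUnity, div_pow, ← smul_pow', hx, smul_toTop, div_self']⟩
  property := by
    refine ⟨?_, ?_⟩
    · refine IsLocallyConstant.desc _ (fun ξ : Additive (rootsOfUnity m L) =>
        ((ξ.toMul : Lˣ) : L)) ?_ ?_
      · have h : Continuous fun g : Fin 1 → Gal(L/F) => g 0 := continuous_apply 0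
        exact ((isLocallyConstant_apply (x : L)).comp_continuous h).comp
          (fun y => y * ((x⁻¹ : Lˣ) : L))
      · intro a b h
        exact Additive.toMul.injective (Subtype.ext (Units.ext h))
    · refine AddMonoidHom.mem_ker.2 (funext fun g => ?_)
      rw [d_one]
      apply Additive.toMul.injective
      apply Subtype.ext
      change (g 0 • (g 1 • x / x)) / ((g 0 * g 1) • x / x) * (g 0 • x / x) = 1
      rw [smul_div', mul_smul]
      simp [div_eq_mul_inv, mul_comm, mul_left_comm]

/-- Let `g` be a continuous `1`-cochain with values in `Lˣ` whose coboundary is `m`-divisible,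
so that `g` is a cocycle modulo `m`. This is its cup product `σ ↦ {g(σ), a}` with `a ∈ Fˣ`,
a `1`-cocycle with values in `K₂(L)/m`. -/
noncomputable def symbolCocycle (m : ℕ) (g : cochains Gal(L/F) (Additive Lˣ) 1)
    (f : cocycles (unitsRep F L) 2) (h : d (unitsRep F L) 1 g.1 = m • f.1) (a : Fˣ) :
    cocycles (milnorRep F L m) 1 where
  val s := milnorSymbol L m (g.1 s).toMul (toTop a)
  property := by
    refine ⟨IsLocallyConstant.comp g.2 fun y => milnorSymbol L m y.toMul (toTop a), ?_⟩
    refine AddMonoidHom.mem_ker.2 (funext fun s => ?_)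
    have hs := congrFun h s
    rw [d_one] at hs ⊢
    have key : ∀ x : Additive Lˣ, milnorRep F L m (s 0) (milnorSymbol L m x.toMul (toTop a)) =
        milnorSymbol L m ((unitsRep F L (s 0) x)).toMul (toTop a) := by
      intro x
      change milnorSymbol L m (s 0 • x.toMul) (s 0 • toTop a) = _
      rw [smul_toTop]
      rfl
    rw [key]
    change QuotientAddGroup.mk' (milnorRelations L m) _ - QuotientAddGroup.mk' _ _ +
      QuotientAddGroup.mk' _ _ = 0
    rw [← map_sub, ← map_add, ← TensorProduct.sub_tmul, ← TensorProduct.add_tmul]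
    simp only [ofMul_toMul]
    rw [hs]
    refine (QuotientAddGroup.eq_zero_iff _).2 (AddSubgroup.subset_closure (Or.inr
      ⟨f.1 s ⊗ₜ[ℤ] Additive.ofMul (toTop a), ?_⟩))
    rw [TensorProduct.smul_tmul']
    rfl

end GaloisModule

namespace Br

open DiscreteCohomology GaloisModule

variable {F : Type u} [Field F]

/-- `a` is the reduced norm of the element `x` of the central simple `F`-algebra `A`: the
determinant of the image of `x` under a splitting `A → Mₙ(F_alg)`, where `n` is the degree
of `A`. -/
def IsReducedNorm {A : Type u} [Ring A] [Algebra F A] (x : A) (a : F) : Prop :=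
  ∃ (n : ℕ) (φ : A →ₐ[F] Matrix (Fin n) (Fin n) (AlgebraicClosure F)),
    n ^ 2 = Module.finrank F A ∧ (φ x).det = algebraMap F (AlgebraicClosure F) a

/-- `Nrd(α) ⊆ Fˣ`: the nonzero reduced norms from the central division algebra `D` of
class `α`. -/
def nrd (α : Br F) : Set Fˣ :=
  {a | ∃ D : CSA.{u, u} F, (∀ x : D, x ≠ 0 → IsUnit x) ∧ mk D = α ∧
    ∃ x : D, IsReducedNorm x (a : F)}

/-- The Suslin group of an arbitrary Brauer class: the subgroup of `Fˣ` generated by the `i`-th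
powers of the elements of `Nrd(iα)`, for all `i ≥ 1`. -/
def suslinGroup (α : Br F) : Subgroup Fˣ :=
  Subgroup.closure {a | ∃ i : ℕ, 1 ≤ i ∧ ∃ b ∈ nrd (i • α), a = b ^ i}

/-- The Suslin group `Nrd(α) · Nrd(ℓα)^ℓ ⋯ Nrd(ℓⁿα)^(ℓⁿ)` of a class of period `ℓⁿ`. -/
def primarySuslinGroup (ℓ n : ℕ) (α : Br F) : Subgroup Fˣ :=
  Subgroup.closure {a | ∃ i : ℕ, i ≤ n ∧ ∃ b ∈ nrd (ℓ ^ i • α), a = b ^ ℓ ^ i}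

/-- The `2`-cocycle `f` of `Gal(L/F)` with values in `Lˣ` represents the Brauer class `α`.
Here `φ` is a splitting over `L` of an algebra `A` of class `α`, the matrices `u σ` compare `φ`
with its conjugates by the Galois group, so that they form a `1`-cocycle with values in `PGLₙ(L)`,
and `f` is the image of this cocycle under the connecting map to `H²(Gal(L/F), Lˣ)`. -/
def IsBrauerCocycle {L : Type u} [Field L] [Algebra F L] (α : Br F)
    (f : (Fin 2 → Gal(L/F)) → Additive Lˣ) : Prop :=
  ∃ (A : CSA.{u, u} F) (n : ℕ) (φ : A →ₐ[F] Matrix (Fin n) (Fin n) L)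
    (u : Gal(L/F) → GL (Fin n) L),
    mk A = α ∧ n ^ 2 = Module.finrank F A ∧ IsLocallyConstant u ∧
    (∀ (σ : Gal(L/F)) (x : A), (u σ).1 * (φ x).map σ = φ x * (u σ).1) ∧
    ∀ σ τ : Gal(L/F), (u σ).1 * (u τ).1.map σ = ((f ![σ, τ]).toMul : L) • (u (σ * τ)).1

/-- `α ∪ (a) = 0` in `H³(F, ℚ_ℓ/ℤ_ℓ(2))`, for `ℓ` invertible in `F`, with `L` a separable closure
of `F`. The group is the inductive limit of the groups `H³(F, μ_m ⊗ μ_m)`, `m = ℓʳ`, so that the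
class vanishes if and only if it does so for some `r`; for `m = ℓʳ` it is the cup product of a
cocycle with values in `μ_m` that represents `α` and the Kummer class of `a`. -/
def CupVanishesTame (L : Type u) [Field L] [Algebra F L] [Algebra.IsIntegral F L] (ℓ : ℕ)
    (α : Br F) (a : Fˣ) : Prop :=
  ∃ (r : ℕ) (c : cocycles (muRep F L (ℓ ^ r)) 2) (x : Lˣ) (hx : x ^ ℓ ^ r = toTop a),
    IsBrauerCocycle α (fun g => muIncl L (ℓ ^ r) (c.1 g)) ∧
    H.mk _ 3 (cup (isDiscrete_muRep (ℓ ^ r)) c (kummerCocycle x hx)) = 0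

/-- `α ∪ (a) = 0` in `H³(F, ℚ_p/ℤ_p(2))`, for `p` the characteristic of `F`, with `L` a separable
closure of `F`. Here `Hᵈ⁺¹(F, ℚ_p/ℤ_p(d))` is the inductive limit of the Galois cohomology groups
`H¹(F, K_d(L)/m)`, `m = pʳ`, of Milnor `K`-groups, with multiplication by `p` as transition
maps. A class in `H¹(F, Lˣ/m)` corresponds to the Brauer class of its image under the connecting
map of `1 → Lˣ → Lˣ → Lˣ/m → 1`: it is given by a cochain `g`, its image by the cocycle `f`
with `m • f = d g`. -/
def CupVanishesWild (L : Type u) [Field L] [Algebra F L] (p : ℕ) (α : Br F) (a : Fˣ) : Prop :=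
  ∃ (r : ℕ) (g : cochains Gal(L/F) (Additive Lˣ) 1) (f : cocycles (unitsRep F L) 2)
    (h : d (unitsRep F L) 1 g.1 = p ^ r • f.1),
    IsBrauerCocycle α f.1 ∧ H.mk _ 1 (symbolCocycle (p ^ r) g f h a) = 0

/-- The Rost kernel of an `ℓ`-primary Brauer class `α`: the kernel of the map
`Fˣ → H³(F, ℚ_ℓ/ℤ_ℓ(2))`, `a ↦ α ∪ (a)`. -/
def primaryRostKernel (ℓ : ℕ) (α : Br F) : Set Fˣ :=
  {a | ((ℓ : F) ≠ 0 ∧ CupVanishesTame (SeparableClosure F) ℓ α a) ∨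
    ((ℓ : F) = 0 ∧ CupVanishesWild (SeparableClosure F) ℓ α a)}

/-- `β` is the `ℓ`-primary component of `α`. -/
def IsPrimaryPart (ℓ : ℕ) (α β : Br F) : Prop :=
  (∃ k : ℕ, ℓ ^ k • β = 0) ∧ ∃ m : ℕ, m.Coprime ℓ ∧ m • (α - β) = 0

/-- The Rost kernel of an arbitrary Brauer class `α`: the kernel of the map `a ↦ α ∪ (a)` from
`Fˣ` to `H³(F, ℚ/ℤ(2))`, which is the direct sum of the groups `H³(F, ℚ_ℓ/ℤ_ℓ(2))`, so that the
`ℓ`-component of `α ∪ (a)` is the cup product of the `ℓ`-primary component of `α` with `(a)`. -/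
def rostKernel (α : Br F) : Set Fˣ :=
  {a | ∀ ℓ : ℕ, ℓ.Prime → ∃ β : Br F, IsPrimaryPart ℓ α β ∧ a ∈ primaryRostKernel ℓ β}

end Br

/-- `F` is Rost `ℓⁿ`-divisible: the Rost kernel equals the Suslin group for all Brauer classes
whose period divides `ℓⁿ`. -/
def RostPowDivisible (F : Type u) [Field F] (ℓ n : ℕ) : Prop :=
  ∀ (α : Br F) (k : ℕ), k ≤ n → addOrderOf α = ℓ ^ k →
    Br.primaryRostKernel ℓ α = Br.primarySuslinGroup ℓ k α

/-- `F` is Rost divisible: it is Rost `ℓⁿ`-divisible for all primes `ℓ` and all `n ≥ 1`. -/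
def RostDivisible (F : Type u) [Field F] : Prop :=
  ∀ ℓ : ℕ, ℓ.Prime → ∀ n : ℕ, 1 ≤ n → RostPowDivisible F ℓ n

/-! The Rost kernel of `α` is by definition the intersection over all primes `ℓ` of the Rost kernels
of the primary components `α_ℓ`, which the hypothesis identifies with primary Suslin groups. It
remains to show that the Suslin group of `α` is the intersection of those of the `α_ℓ`. Cohomology
enters only once more, in `primaryRostKernel_zero`, for the primes that do not divide `N`.

The engine is `nrd_subset_nsmul`: `Nrd(α) ⊆ Nrd(mα)`. An element of a division algebra lies in a
maximal subfield `L`, and its reduced norm is its norm from `L`. As `L` splits the class, it splits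
every multiple. Conversely, the norm of any element of a finite splitting field is a reduced norm:
`L` embeds as a maximal subfield in a matrix algebra over the division algebra, and Gaussian
elimination reduces a matrix to a single element (`exists_det_eq_norm`).

Inclusion in each primary Suslin group: for a generator `b ^ i`, write `i = ℓʲm` with `m` prime to
`ℓ`. A multiple of `iα` is `ℓʲα_ℓ`, so `b` lies in `Nrd(ℓʲα_ℓ)`. Converse: if `M` is prime to `ℓ`
and kills `α - α_ℓ`, then `M`-th powers of elements of the Suslin group of `α_ℓ` lie in that of `α`.
So do `N`-th powers of all elements, as `Nrd(Nα) = Fˣ`. These exponents have no common prime factor,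
hence the element itself lies in the group.

The second statement also needs that `Br(F)` is torsion (`exists_nsmul_eq_zero`): determinants of
the comparison matrices of a Galois splitting show that the degree of an algebra kills its cocycle
up to a coboundary, and by Galois descent a class with such a cocycle is trivial. -/

/-! ### Reduced characteristic polynomials and maximal subfields -/

theorem Matrix.charpoly_blockDiagonal {R m o : Type*} [CommRing R] [Fintype m] [DecidableEq m]
    [Fintype o] [DecidableEq o] (M : o → Matrix m m R) :
    (Matrix.blockDiagonal M).charpoly = ∏ k, (M k).charpoly := by
  have h : (Matrix.blockDiagonal M).charmatrix =
      Matrix.blockDiagonal fun k => (M k).charmatrix := by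
    ext ⟨i, k⟩ ⟨j, l⟩
    by_cases hkl : k = l
    · subst hkl
      simp [Matrix.charmatrix_apply, Matrix.diagonal_apply, Matrix.blockDiagonal_apply]
    · simp [Matrix.blockDiagonal_apply, hkl]
  rw [Matrix.charpoly, h, Matrix.det_blockDiagonal]
  rfl

/-- The characteristic polynomial of an endomorphism that is a direct sum of copies of `g`. -/
theorem LinearMap.charpoly_of_pi {K U V ι : Type*} [Field K] [AddCommGroup U] [Module K U]
    [FiniteDimensional K U] [AddCommGroup V] [Module K V] [FiniteDimensional K V] [Fintype ι]
    [DecidableEq ι] (g : U →ₗ[K] U) (f : V →ₗ[K] V) (e : V ≃ₗ[K] (ι → U))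
    (h : ∀ v i, e (f v) i = g (e v i)) : f.charpoly = g.charpoly ^ Fintype.card ι := by
  let b := Module.finBasis K U
  let B := (((Pi.basis fun _ : ι => b).reindex (Equiv.sigmaEquivProd _ _)).reindex
    (Equiv.prodComm _ _)).map e.symm
  have hM : LinearMap.toMatrix B B f = Matrix.blockDiagonal fun _ : ι => LinearMap.toMatrix b b g := by
    ext ⟨i₁, i₂⟩ ⟨j₁, j₂⟩
    have hs : e (f (e.symm (Pi.single j₂ (b j₁)))) = Pi.single j₂ (g (b j₁)) := by
      ext i
      rw [h, LinearEquiv.apply_symm_apply]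
      rcases eq_or_ne i j₂ with rfl | hi
      · simp
      · simp [hi]
    simp only [B, LinearMap.toMatrix_apply, Matrix.blockDiagonal_apply]
    simp only [Module.Basis.map_apply, Module.Basis.map_repr, LinearEquiv.trans_apply,
      Module.Basis.coe_reindex, Function.comp_apply, Equiv.prodComm_symm, Equiv.prodComm_apply,
      Prod.swap_prod_mk, Equiv.sigmaEquivProd_symm_apply, Pi.basis_apply, LinearEquiv.symm_symm,
      Module.Basis.repr_reindex, Finsupp.mapDomain_equiv_apply, Pi.basis_repr, hs]
    rcases eq_or_ne i₂ j₂ with rfl | hi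
    · simp
    · simp [hi]
  rw [← LinearMap.charpoly_toMatrix f B, hM, Matrix.charpoly_blockDiagonal, Finset.prod_const,
    Finset.card_univ, LinearMap.charpoly_toMatrix]

/-- Unique factorization, with monicity to remove the unit. It extracts roots from identities
between powers of reduced characteristic polynomials. -/
theorem Polynomial.Monic.eq_of_pow_eq {K : Type*} [Field K] {p q : Polynomial K} (hp : p.Monic)
    (hq : q.Monic) {d : ℕ} (hd : d ≠ 0) (h : p ^ d = q ^ d) : p = q :=
  Polynomial.eq_of_monic_of_associated hp hq <| associated_of_dvd_dvd
    ((UniqueFactorizationMonoid.pow_dvd_pow_iff_dvd hd).1 h.dvd)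
    ((UniqueFactorizationMonoid.pow_dvd_pow_iff_dvd hd).1 h.symm.dvd)

namespace Brauer

variable {F : Type*} [Field F]

/-- The `K`-linear extension of a matrix representation over an extension field `K`. -/
noncomputable def baseChangeRep {A K ι : Type*} [Ring A] [Algebra F A] [Field K] [Algebra F K]
    [Fintype ι] [DecidableEq ι] (φ : A →ₐ[F] Matrix ι ι K) : K ⊗[F] A →ₐ[K] Matrix ι ι K :=
  Algebra.TensorProduct.lift (Algebra.ofId K (Matrix ι ι K)) φ
    fun k a => by rw [Algebra.ofId_apply]; exact Algebra.commute_algebraMap_left k (φ a)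

theorem baseChangeRep_one_tmul {A K ι : Type*} [Ring A] [Algebra F A] [Field K] [Algebra F K]
    [Fintype ι] [DecidableEq ι] (φ : A →ₐ[F] Matrix ι ι K) (a : A) :
    baseChangeRep φ (1 ⊗ₜ a) = φ a := by
  rw [baseChangeRep, Algebra.TensorProduct.lift_tmul, map_one, one_mul]

/-- A representation of a central simple algebra over an extension field, of dimension the degree
of the algebra, induces an isomorphism of the base change with a matrix algebra. -/
theorem bijective_baseChangeRep {A K ι : Type*} [Ring A] [Algebra F A] [Algebra.IsCentral F A]
    [IsSimpleRing A] [FiniteDimensional F A] [Field K] [Algebra F K] [Fintype ι] [DecidableEq ι]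
    (φ : A →ₐ[F] Matrix ι ι K) (h : Fintype.card ι ^ 2 = Module.finrank F A) :
    Function.Bijective (baseChangeRep φ) := by
  have hpos : 0 < Module.finrank F A := Module.finrank_pos
  have : Nonempty ι := by
    rw [← Fintype.card_pos_iff]
    by_contra h0
    simp [Nat.eq_zero_of_not_pos h0] at h
    omega
  have : IsSimpleRing (K ⊗[F] A) :=
    IsSimpleRing.of_ringEquiv (Algebra.TensorProduct.comm F A K).toRingEquiv inferInstance
  set ψ := baseChangeRep φ
  have hinj : Function.Injective ψ := ψ.toRingHom.injective
  refine ⟨hinj, ?_⟩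
  refine (LinearMap.injective_iff_surjective_of_finrank_eq_finrank (f := ψ.toLinearMap) ?_).1 hinj
  rw [Module.finrank_baseChange, Module.finrank_matrix, Module.finrank_self, ← h]
  ring

/-- Left multiplication acts on each column separately, so it is a direct sum of copies of `M`
acting on column vectors. -/
theorem charpoly_mulLeft_matrix {K ι : Type*} [Field K] [Fintype ι] [DecidableEq ι]
    (M : Matrix ι ι K) :
    (LinearMap.mulLeft K M).charpoly = M.charpoly ^ Fintype.card ι := by
  rw [← Matrix.charpoly_mulVecLin]
  exact LinearMap.charpoly_of_pi M.mulVecLin _ (Matrix.transposeLinearEquiv ι ι K K) fun N i => rfl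

/-- After base change to `K`, left multiplication by `a` becomes left multiplication by `φ a` on the
full matrix algebra. The right-hand side does not depend on `φ`. -/
theorem charpoly_pow {A K ι : Type*} [Ring A] [Algebra F A] [Algebra.IsCentral F A]
    [IsSimpleRing A] [FiniteDimensional F A] [Field K] [Algebra F K] [Fintype ι] [DecidableEq ι]
    (φ : A →ₐ[F] Matrix ι ι K) (h : Fintype.card ι ^ 2 = Module.finrank F A) (a : A) :
    (φ a).charpoly ^ Fintype.card ι =
      (LinearMap.mulLeft F a).charpoly.map (algebraMap F K) := by
  rw [← LinearMap.charpoly_baseChange, ← charpoly_mulLeft_matrix]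
  let e := LinearEquiv.ofBijective (baseChangeRep φ).toLinearMap (bijective_baseChangeRep φ h)
  rw [← e.charpoly_conj ((LinearMap.mulLeft F a).baseChange K)]
  congr 1
  ext1 M
  obtain ⟨x, rfl⟩ := e.surjective M
  simp only [LinearEquiv.conj_apply, LinearMap.comp_apply, LinearEquiv.coe_coe,
    LinearEquiv.symm_apply_apply]
  have : (LinearMap.mulLeft F a).baseChange K x = (1 ⊗ₜ a) * x := by
    induction x using TensorProduct.induction_on with
    | zero => simp
    | tmul c d => simp
    | add x y hx hy => simp [mul_add, hx, hy]
  rw [this]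
  refine Eq.trans ?_ (map_mul (baseChangeRep φ) (1 ⊗ₜ a) x).symm
  rw [baseChangeRep_one_tmul]
  rfl

/-- The reduced characteristic polynomial of an element of a maximal subfield. -/
theorem charpoly_of_maximal_subfield {B L K ι : Type*} [Ring B] [Algebra F B]
    [Algebra.IsCentral F B] [IsSimpleRing B] [FiniteDimensional F B] [Field K] [Algebra F K]
    [Fintype ι] [DecidableEq ι] [Field L] [Algebra F L] [FiniteDimensional F L]
    (Φ : B →ₐ[F] Matrix ι ι K) (h : Fintype.card ι ^ 2 = Module.finrank F B)
    (j : L →ₐ[F] B) (hL : Module.finrank F L = Fintype.card ι) (y : L) :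
    (Φ (j y)).charpoly = (LinearMap.mulLeft F y).charpoly.map (algebraMap F K) := by
  have hι : Fintype.card ι ≠ 0 := by
    rw [← hL]; exact Module.finrank_pos.ne'
  -- With `n = Fintype.card ι`, both `n`-th powers come from left multiplication by `j y` on `B`: as
  -- an `L`-space `B` has dimension `n`, so this is `n` copies of multiplication by `y` on `L`.
  refine Polynomial.Monic.eq_of_pow_eq (Matrix.charpoly_monic _)
    ((LinearMap.charpoly_monic _).map _) hι ?_
  rw [charpoly_pow Φ h, ← Polynomial.map_pow]
  congr 1
  let _ : Module L B := Module.compHom B j.toRingHom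
  have hsmul : ∀ (l : L) (b : B), l • b = j l * b := fun _ _ => rfl
  have : IsScalarTower F L B := ⟨fun c l b => by simp [hsmul]⟩
  have : Module.Finite L B := Module.Finite.of_restrictScalars_finite F L B
  have hdim : Module.finrank L B = Fintype.card ι := by
    have := Module.finrank_mul_finrank F L B
    rw [hL, ← h, sq] at this
    exact Nat.eq_of_mul_eq_mul_left (Nat.pos_of_ne_zero hι) this
  let e := (Module.finBasisOfFinrankEq L B hdim).equivFun.restrictScalars F
  rw [← Fintype.card_fin (Fintype.card ι)]
  refine LinearMap.charpoly_of_pi _ _ e fun v i => ?_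
  change (Module.finBasisOfFinrankEq L B hdim).equivFun (y • v) i = _
  rw [map_smul]
  rfl

theorem det_of_maximal_subfield {B L K ι : Type*} [Ring B] [Algebra F B]
    [Algebra.IsCentral F B] [IsSimpleRing B] [FiniteDimensional F B] [Field K] [Algebra F K]
    [Fintype ι] [DecidableEq ι] [Field L] [Algebra F L] [FiniteDimensional F L]
    (Φ : B →ₐ[F] Matrix ι ι K) (h : Fintype.card ι ^ 2 = Module.finrank F B)
    (j : L →ₐ[F] B) (hL : Module.finrank F L = Fintype.card ι) (y : L) :
    (Φ (j y)).det = algebraMap F K (Algebra.norm F y) := by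
  rw [Matrix.det_eq_sign_charpoly_coeff, charpoly_of_maximal_subfield Φ h j hL,
    Polynomial.coeff_map, Algebra.norm_apply, LinearMap.det_eq_sign_charpoly_coeff, hL]
  simp
  rfl

end Brauer

/-! ### Elimination over a division ring: norms as reduced norms -/

namespace Brauer

/-- The determinant of a square matrix over a division ring, after entrywise substitution of a
matrix representation, is the determinant of the image of a single element. -/
theorem exists_det_comp_eq {D K ι : Type*} [DivisionRing D] [Field K] [Fintype ι] [DecidableEq ι]
    [Nonempty ι] (φ : D →+* Matrix ι ι K) (r : ℕ) (Y : Matrix (Fin r) (Fin r) D) :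
    ∃ d : D, (Matrix.comp _ _ _ _ K (Y.map φ)).det = (φ d).det := by
  induction r with
  | zero => exact ⟨1, by simp⟩
  | succ r ih =>
    -- the case of a nonzero corner, by the Schur complement
    have corner : ∀ Y : Matrix (Fin (r + 1)) (Fin (r + 1)) D, Y 0 0 ≠ 0 →
        ∃ d : D, (Matrix.comp _ _ _ _ K (Y.map φ)).det = (φ d).det := by
      intro Y hY
      let e : ι ⊕ (Fin r × ι) ≃ Fin (r + 1) × ι :=
        { toFun := Sum.elim (fun i => (0, i)) fun p => (p.1.succ, p.2)
          invFun := fun p => Fin.cases (motive := fun _ => ι ⊕ (Fin r × ι)) (.inl p.2)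
            (fun k => .inr (k, p.2)) p.1
          left_inv := by rintro (i | ⟨k, i⟩) <;> simp
          right_inv := by
            rintro ⟨k, i⟩
            refine Fin.cases ?_ (fun k => ?_) k <;> simp }
      -- The Schur complement of the corner, formed over `D`; `φ` carries it to the Schur complement
      -- of the block matrix over `K`.
      let Z : Matrix (Fin r) (Fin r) D := .of fun k l =>
        Y k.succ l.succ - Y k.succ 0 * (Y 0 0)⁻¹ * Y 0 l.succ
      obtain ⟨d, hd⟩ := ih Z
      refine ⟨Y 0 0 * d, ?_⟩
      let _ : Invertible (φ (Y 0 0)) :=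
        ⟨φ (Y 0 0)⁻¹, by rw [← map_mul, inv_mul_cancel₀ hY, map_one],
          by rw [← map_mul, mul_inv_cancel₀ hY, map_one]⟩
      have hinv : ⅟(φ (Y 0 0)) = φ (Y 0 0)⁻¹ := rfl
      rw [map_mul, Matrix.det_mul, ← hd, ← Matrix.det_submatrix_equiv_self e]
      let B : Matrix ι (Fin r × ι) K := .of fun i p => φ (Y 0 p.1.succ) i p.2
      let C : Matrix (Fin r × ι) ι K := .of fun p i => φ (Y p.1.succ 0) p.2 i
      let E : Matrix (Fin r × ι) (Fin r × ι) K := .of fun p q => φ (Y p.1.succ q.1.succ) p.2 q.2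
      have hblocks : (Matrix.comp _ _ _ _ K (Y.map φ)).submatrix e e =
          Matrix.fromBlocks (φ (Y 0 0)) B C E := by
        ext (i | p) (j | q) <;> rfl
      have hschur : E - C * ⅟(φ (Y 0 0)) * B = Matrix.comp _ _ _ _ K (Z.map φ) := by
        ext ⟨k, i⟩ ⟨l, j⟩
        have h : Matrix.comp _ _ _ _ K (Z.map φ) (k, i) (l, j) =
          φ (Y k.succ l.succ - Y k.succ 0 * (Y 0 0)⁻¹ * Y 0 l.succ) i j := rfl
        rw [h, map_sub, map_mul, map_mul, hinv]
        rfl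
      rw [hblocks, Matrix.det_fromBlocks₁₁, hschur]
    -- A zero first row gives determinant zero, which is the determinant of `φ 0` because `ι` is
    -- nonempty.
    by_cases h0 : ∀ j, Y 0 j = 0
    · refine ⟨0, ?_⟩
      rw [map_zero, Matrix.det_zero]
      obtain ⟨i⟩ := ‹Nonempty ι›
      refine Matrix.det_eq_zero_of_row_eq_zero (0, i) fun ⟨j, l⟩ => ?_
      simp [Matrix.comp_apply, h0 j]
    push Not at h0
    obtain ⟨j, hj⟩ := h0
    by_cases h00 : Y 0 0 = 0
    · have hj0 : j ≠ 0 := by rintro rfl; exact hj h00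
      -- Adding column `j` to column `0` makes the corner nonzero; over `K` this operation has
      -- determinant 1.
      have hT : Matrix.comp _ _ _ _ K ((1 + Matrix.single j 0 (1 : D)).map φ) =
          Matrix.kronecker (Matrix.transvection j 0 (1 : K)) (1 : Matrix ι ι K) := by
        ext ⟨k, i⟩ ⟨l, m⟩
        change φ ((1 : Matrix _ _ D) k l + Matrix.single j 0 (1 : D) k l) i m =
          ((1 : Matrix _ _ K) k l + Matrix.single j 0 (1 : K) k l) * (1 : Matrix ι ι K) i m
        rw [map_add, Matrix.add_apply, add_mul]
        congr 1
        · by_cases h : k = l <;> simp [h, Matrix.one_apply]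
        · by_cases h : j = k ∧ 0 = l <;> simp [h, Matrix.one_apply]
      obtain ⟨d, hd⟩ := corner (Y * (1 + Matrix.single j 0 1))
        (by simpa [mul_add, h00] using hj)
      refine ⟨d, ?_⟩
      rw [← hd, Matrix.map_mul, ← Matrix.compRingEquiv_apply, ← Matrix.compRingEquiv_apply,
        map_mul, Matrix.det_mul, Matrix.compRingEquiv_apply _ _ _ (Matrix.map (1 + Matrix.single j 0 1) φ),
        hT, Matrix.kronecker, Matrix.det_kronecker, Matrix.det_transvection_of_ne _ _ hj0]
      simp
    · exact corner Y h00

/-- The matrices over `D` that describe the action on a free `D`-module of a field `L` that commutes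
with `D`. Matrices act on row vectors, and the order of products does not matter as `L` is
commutative. -/
def matrixOfCommuting {F D L W : Type*} [Field F] [DivisionRing D] [Algebra F D] [Field L]
    [Algebra F L] [AddCommGroup W] [Module L W] [Module F W] [IsScalarTower F L W]
    [Module D W] [IsScalarTower F D W]
    [SMulCommClass L D W] {r : ℕ} (e : W ≃ₗ[D] (Fin r → D)) :
    L →ₐ[F] Matrix (Fin r) (Fin r) D where
  toFun y := LinearMap.toMatrixRight'
    ((e.toLinearMap ∘ₗ DistribSMul.toLinearMap D W y) ∘ₗ e.symm.toLinearMap)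
  map_one' := by
    apply Matrix.toLinearMapRight'.injective
    apply LinearMap.ext
    intro v
    simp
  map_mul' y z := by
    apply Matrix.toLinearMapRight'.injective
    rw [Matrix.toLinearMapRight'_mul]
    apply LinearMap.ext
    intro v
    simp [mul_comm y z, mul_smul]
  map_zero' := by
    apply Matrix.toLinearMapRight'.injective
    apply LinearMap.ext
    intro v
    simp
  map_add' y z := by
    apply Matrix.toLinearMapRight'.injective
    apply LinearMap.ext
    intro v
    simp [add_smul]
  commutes' c := by
    apply Matrix.toLinearMapRight'.injective
    apply LinearMap.ext
    intro v
    have h : ∀ w : W, (algebraMap F L c) • w = (algebraMap F D c) • w := fun w => by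
      rw [algebraMap_smul, algebraMap_smul]
    simp only [LinearEquiv.symm_apply_apply, LinearMap.comp_apply, LinearEquiv.coe_coe,
      DistribSMul.toLinearMap_apply, h, map_smul, LinearEquiv.apply_symm_apply]
    ext i
    simp [Matrix.algebraMap_eq_diagonal, Matrix.vecMul_diagonal, Algebra.commutes]

/-- As a `D`-space `W` has some dimension `r`, so the commuting field `L` embeds in `r × r` matrices
over `D`. It is a maximal subfield there, hence the norm of `y` is the reduced norm of a matrix, and
elimination replaces the matrix by one element of `D`. -/
theorem exists_det_eq_norm {F D L W K ι : Type*} [Field F] [DivisionRing D] [Algebra F D]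
    [FiniteDimensional F D] [Algebra.IsCentral F D] [Field L] [Algebra F L]
    [FiniteDimensional F L] [AddCommGroup W] [Module L W] [Module.Finite L W]
    [Module F W] [IsScalarTower F L W] [Module D W] [IsScalarTower F D W] [SMulCommClass L D W]
    [Field K] [Algebra F K] [Fintype ι] [DecidableEq ι]
    (hι : Fintype.card ι ^ 2 = Module.finrank F D) (hW : Module.finrank L W = Fintype.card ι)
    (φ : D →ₐ[F] Matrix ι ι K) (y : L) :
    ∃ d : D, (φ d).det = algebraMap F K (Algebra.norm F y) := by
  have hcard : Fintype.card ι ≠ 0 := by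
    intro h
    rw [h] at hι
    have : 0 < Module.finrank F D := Module.finrank_pos
    omega
  have : Nonempty ι := Fintype.card_pos_iff.1 (Nat.pos_of_ne_zero hcard)
  have : Module.Finite F W := Module.Finite.trans L W
  have : Module.Finite D W := Module.Finite.of_restrictScalars_finite F D W
  have : Nontrivial W := Module.nontrivial_of_finrank_pos (R := L) (by omega)
  let r := Module.finrank D W
  have hr : 0 < r := Module.finrank_pos
  let e : W ≃ₗ[D] (Fin r → D) := (Module.finBasis D W).equivFun
  let Φ : Matrix (Fin r) (Fin r) D →ₐ[F] Matrix (Fin r × ι) (Fin r × ι) K :=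
    (Matrix.compAlgEquiv (Fin r) ι K F).toAlgHom.comp φ.mapMatrix
  have : Nonempty (Fin r) := ⟨⟨0, hr⟩⟩
  -- Count the dimension of `W` over `F` through `L` and through `D`: with `n = Fintype.card ι`,
  -- `[L:F] n = n² r`.
  have hL : Module.finrank F L = Fintype.card (Fin r × ι) := by
    have h1 := Module.finrank_mul_finrank F L W
    have h2 := Module.finrank_mul_finrank F D W
    rw [hW] at h1
    rw [← hι, ← h1] at h2
    rw [Fintype.card_prod, Fintype.card_fin]
    refine Nat.eq_of_mul_eq_mul_right (Nat.pos_of_ne_zero hcard) ?_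
    rw [← h2]
    ring
  have hdim : Fintype.card (Fin r × ι) ^ 2 = Module.finrank F (Matrix (Fin r) (Fin r) D) := by
    rw [Module.finrank_matrix, ← hι, Fintype.card_prod]
    ring
  obtain ⟨d, hd⟩ := exists_det_comp_eq φ.toRingHom r (matrixOfCommuting (F := F) (L := L) e y)
  refine ⟨d, ?_⟩
  rw [← det_of_maximal_subfield Φ hdim (matrixOfCommuting (F := F) e) hL y]
  exact hd.symm

end Brauer

/-! ### Representations of tensor products and matrix algebras -/

namespace Brauer

/-- The tensor product of two matrix representations over an extension field. -/
noncomputable def kroneckerRep {F L A B m n : Type*} [Field F] [Field L] [Algebra F L] [Ring A]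
    [Ring B] [Algebra F A] [Algebra F B] [Fintype m] [DecidableEq m] [Fintype n] [DecidableEq n]
    (φ : A →ₐ[F] Matrix m m L) (ψ : B →ₐ[F] Matrix n n L) :
    A ⊗[F] B →ₐ[F] Matrix (m × n) (m × n) L :=
  (Algebra.TensorProduct.lmul' F (S := L)).mapMatrix.comp <|
    (Matrix.kroneckerTMulAlgEquiv m n F F L L).toAlgHom.comp (Algebra.TensorProduct.map φ ψ)

theorem kroneckerRep_tmul {F L A B m n : Type*} [Field F] [Field L] [Algebra F L] [Ring A]
    [Ring B] [Algebra F A] [Algebra F B] [Fintype m] [DecidableEq m] [Fintype n] [DecidableEq n]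
    (φ : A →ₐ[F] Matrix m m L) (ψ : B →ₐ[F] Matrix n n L) (a : A) (b : B) :
    kroneckerRep φ ψ (a ⊗ₜ b) = Matrix.kronecker (φ a) (ψ b) := by
  ext ⟨i, k⟩ ⟨j, l⟩
  simp [kroneckerRep]

/-- A representation of a matrix algebra `Mₛ(B)` is the sum of `s` copies of a representation
of `B`. -/
theorem exists_rep_of_matrix {F L B W : Type*} [Field F] [Field L] [Algebra F L] [Ring B]
    [Algebra F B] [AddCommGroup W] [Module L W] [Module F W] [IsScalarTower F L W]
    [Module.Finite L W] {s : ℕ} [NeZero s]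
    (T : Matrix (Fin s) (Fin s) B →ₐ[F] Module.End L W) :
    ∃ (n : ℕ) (_ : B →ₐ[F] Matrix (Fin n) (Fin n) L), Module.finrank L W = s * n := by
  let E (i j : Fin s) (b : B) : Module.End L W := T (Matrix.single i j b)
  have hE : ∀ i j k b c w, E i j b (E j k c w) = E i k (b * c) w := by
    intro i j k b c w
    change (T _ * T _) w = _
    rw [← map_mul, Matrix.single_mul_single_same]
  have hE0 : ∀ i j j' k b c w, j ≠ j' → E i j b (E j' k c w) = 0 := by
    intro i j j' k b c w h
    change (T _ * T _) w = _
    rw [← map_mul, Matrix.single_mul_single_of_ne (h := h), map_zero]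
    rfl
  have hsum : ∀ w, ∑ i, E i i 1 w = w := by
    intro w
    rw [← LinearMap.sum_apply]
    simp only [E]
    rw [← map_sum, Matrix.sum_single_one, map_one]
    rfl
  -- The image of the idempotent matrix unit at `(0, 0)`. The units `E 0 i 1` and `E i 0 1` identify
  -- `W` with `s` copies of it, and `B` acts on it through the corner.
  let V : Submodule L W := LinearMap.eqLocus (E 0 0 1) LinearMap.id
  have hV : ∀ w, w ∈ V ↔ E 0 0 1 w = w := fun w => Iff.rfl
  have hmem : ∀ j b w, E 0 j b w ∈ V := fun j b w => by rw [hV, hE, one_mul]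
  let e : W ≃ₗ[L] (Fin s → V) :=
    { toFun := fun w i => ⟨E 0 i 1 w, hmem _ _ _⟩
      map_add' := fun v w => by ext; simp
      map_smul' := fun c w => by ext; simp
      invFun := fun f => ∑ i, E i 0 1 (f i)
      left_inv := fun w => by simp only [hE, one_mul, hsum]
      right_inv := fun f => by
        ext i
        simp only [map_sum]
        rw [Finset.sum_eq_single i, hE, one_mul]
        · exact (f i).2
        · intro j _ hj
          exact hE0 _ _ _ _ _ _ _ hj.symm
        · simp }
  let ρ : B →ₐ[F] Module.End L V :=
    { toFun := fun b => (E 0 0 b).restrict fun w _ => hmem _ _ _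
      map_one' := by
        ext w
        exact w.2
      map_mul' := fun b c => by
        ext w
        exact (hE 0 0 0 b c w).symm
      map_zero' := by ext w; simp [E]
      map_add' := fun b c => by ext w; simp [E, Matrix.single_add]
      commutes' := fun c => by
        ext w
        change E 0 0 (algebraMap F B c) w = c • (w : W)
        have : Matrix.single (0 : Fin s) (0 : Fin s) (algebraMap F B c) =
            c • Matrix.single 0 0 (1 : B) := by
          rw [Matrix.smul_single, Algebra.algebraMap_eq_smul_one]
        simp only [E, this, map_smul, LinearMap.smul_apply]
        exact congrArg (c • ·) w.2 }
  refine ⟨Module.finrank L V,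
    ((algEquivMatrix (Module.finBasis L V)).restrictScalars F).toAlgHom.comp ρ, ?_⟩
  rw [e.finrank_eq, Module.finrank_pi_fintype]
  simp

theorem isCentral_of_matrix {F D : Type*} [Field F] [Ring D] [Algebra F D] (s : ℕ) [NeZero s]
    [Algebra.IsCentral F (Matrix (Fin s) (Fin s) D)] : Algebra.IsCentral F D := by
  refine ⟨fun d hd => ?_⟩
  have : Matrix.scalar (Fin s) d ∈ Subalgebra.center F (Matrix (Fin s) (Fin s) D) := by
    rw [Subalgebra.mem_center_iff] at hd ⊢
    intro M
    exact (Matrix.scalar_commute d (fun x => (hd x).symm) M).eq.symm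
  obtain ⟨c, hc⟩ := (Algebra.IsCentral.mem_center_iff F).1 this
  refine Algebra.mem_bot.2 ⟨c, ?_⟩
  have := congrFun (congrFun hc 0) 0
  simpa [Matrix.algebraMap_matrix_apply] using this.symm

end Brauer

/-! ### Splitting fields and their norms -/

namespace Br

open Brauer

variable {F : Type u} [Field F]

/-- The field `L` splits the Brauer class `β`. -/
def IsSplitBy (L : Type u) [Field L] [Algebra F L] (β : Br F) : Prop :=
  ∃ (A : CSA.{u, u} F) (n : ℕ) (_ : A →ₐ[F] Matrix (Fin n) (Fin n) L),
    mk A = β ∧ n ^ 2 = Module.finrank F A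

variable {L : Type u} [Field L] [Algebra F L]

theorem isSplitBy_zero : IsSplitBy L (0 : Br F) :=
  ⟨CSA.base F, 1, Algebra.ofId F (Matrix (Fin 1) (Fin 1) L), rfl,
    by rw [one_pow]; exact (Module.finrank_self F).symm⟩

theorem IsSplitBy.add {α β : Br F} (hα : IsSplitBy L α) (hβ : IsSplitBy L β) :
    IsSplitBy L (α + β) := by
  obtain ⟨A, n, φ, rfl, hA⟩ := hα
  obtain ⟨B, m, ψ, rfl, hB⟩ := hβ
  refine ⟨CSA.tensor A B, n * m, ((Matrix.reindexAlgEquiv F L finProdFinEquiv).toAlgHom.comp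
    (kroneckerRep φ ψ) : A ⊗[F] B →ₐ[F] _), rfl, ?_⟩
  rw [mul_pow, hA, hB]
  exact (Module.finrank_tensorProduct (R := F) (S := F) (M := A) (M' := B)).symm

theorem IsSplitBy.nsmul {α : Br F} (hα : IsSplitBy L α) (k : ℕ) : IsSplitBy L (k • α) := by
  induction k with
  | zero => rw [zero_smul]; exact isSplitBy_zero
  | succ k ih => rw [succ_nsmul]; exact ih.add hα

/-- `IsSplitBy` provides a splitting of one algebra `A` in the class; this transfers it to every
other. If `Mₚ(A) ≅ M_q(B)`, then `p` copies of the representation of `A` form a representation of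
`M_q(B)`, hence `q` copies of one of `B`, and comparing dimensions gives its degree. -/
theorem IsSplitBy.exists_rep {B : CSA.{u, u} F} (h : IsSplitBy L (mk B)) :
    ∃ (n : ℕ) (_ : B →ₐ[F] Matrix (Fin n) (Fin n) L), n ^ 2 = Module.finrank F B := by
  obtain ⟨A, n, φ, hAB, hA⟩ := h
  obtain ⟨p, q, hp, hq, ⟨e⟩⟩ := mk_eq_mk.1 hAB
  have : NeZero q := ⟨hq⟩
  let T : Matrix (Fin q) (Fin q) B →ₐ[F] Module.End L (Fin p × Fin n → L) :=
    (Matrix.toLinAlgEquiv'.restrictScalars F).toAlgHom.comp <|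
      (Matrix.compAlgEquiv (Fin p) (Fin n) L F).toAlgHom.comp <|
        φ.mapMatrix.comp e.symm.toAlgHom
  obtain ⟨n', φ', hn'⟩ := exists_rep_of_matrix T
  refine ⟨n', φ', ?_⟩
  have hdim := e.toLinearEquiv.finrank_eq
  simp only [Module.finrank_matrix, Fintype.card_fin, ← hA] at hdim
  simp only [Module.finrank_pi, Fintype.card_prod, Fintype.card_fin] at hn'
  refine Nat.eq_of_mul_eq_mul_left (Nat.mul_pos (Nat.pos_of_ne_zero hq) (Nat.pos_of_ne_zero hq)) ?_
  rw [← hdim]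
  calc q * q * n' ^ 2 = (q * n') ^ 2 := by ring
    _ = (p * n) ^ 2 := by rw [hn']
    _ = p * p * n ^ 2 := by ring

/-- Every Brauer class is the class of a division algebra. -/
theorem exists_divisionRing (β : Br F) : ∃ (D : Type u) (_ : DivisionRing D) (_ : Algebra F D)
    (_ : FiniteDimensional F D) (_ : Algebra.IsCentral F D) (D' : CSA.{u, u} F)
    (_ : D' ≃ₐ[F] D), mk D' = β := by
  obtain ⟨A, rfl⟩ := mk_surjective β
  have : IsArtinianRing A := IsArtinianRing.of_finite F A
  obtain ⟨s, hs, D, _, _, _, ⟨e⟩⟩ := IsSimpleRing.exists_algEquiv_matrix_divisionRing_finite F A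
  have hc : Algebra.IsCentral F (Matrix (Fin s) (Fin s) D) := Algebra.IsCentral.of_algEquiv F A _ e
  have hD : Algebra.IsCentral F D := isCentral_of_matrix s
  let D' : CSA.{u, u} F :=
    { __ := AlgCat.of F D
      isCentral := hD
      isSimple := inferInstanceAs (IsSimpleRing D)
      fin_dim := inferInstanceAs (FiniteDimensional F D) }
  refine ⟨D, _, _, ‹_›, hD, D', AlgEquiv.refl, mk_eq_mk.2 ?_⟩
  exact ⟨s, 1, NeZero.ne s, one_ne_zero, ⟨e.symm.trans <|
    Matrix.uniqueAlgEquiv.symm.trans (Matrix.reindexAlgEquiv F A finOneEquiv.symm)⟩⟩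

/-- The norms from a finite extension that splits `β` are reduced norms. -/
theorem IsSplitBy.norm_mem_nrd [FiniteDimensional F L] {β : Br F} (h : IsSplitBy L β) (y : L)
    (a : Fˣ) (ha : Algebra.norm F y = a) : a ∈ nrd β := by
  obtain ⟨D, _, _, _, _, D', e, rfl⟩ := exists_divisionRing β
  obtain ⟨n, φ, hn⟩ := h.exists_rep
  let ψ : D →ₐ[F] Matrix (Fin n) (Fin n) L := φ.comp e.symm.toAlgHom
  let Ψ : D →ₐ[F] Module.End L (Fin n → L) :=
    (Matrix.toLinAlgEquiv'.restrictScalars F).toAlgHom.comp ψ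
  -- The splitting turns `Lⁿ` into a `D`-module whose action commutes with the scalars in `L`, as
  -- `exists_det_eq_norm` requires.
  let _ : Module D (Fin n → L) := Module.compHom _ Ψ.toRingHom
  have hsmul : ∀ (d : D) (w : Fin n → L), d • w = Ψ d w := fun _ _ => rfl
  have : IsScalarTower F D (Fin n → L) := ⟨fun c d w => by simp [hsmul]⟩
  have : SMulCommClass L D (Fin n → L) := ⟨fun c d w => by simp [hsmul]⟩
  have hn' : Fintype.card (Fin n) ^ 2 = Module.finrank F D := by
    rw [Fintype.card_fin, hn, e.toLinearEquiv.finrank_eq]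
  -- Reduced norms are defined over the algebraic closure, so `L` is embedded in it.
  let θ : D →ₐ[F] Matrix (Fin n) (Fin n) (AlgebraicClosure F) :=
    (IsAlgClosed.lift (R := F) (S := L) (M := AlgebraicClosure F)).mapMatrix.comp ψ
  obtain ⟨d, hd⟩ := exists_det_eq_norm (W := Fin n → L) hn' (by simp) θ y
  refine ⟨D', fun x hx => ?_, rfl, e.symm d, n, θ.comp e.toAlgHom, hn, ?_⟩
  · have : IsUnit (e x) := isUnit_iff_ne_zero.2 (by simpa using hx)
    simpa using this.map e.symm
  · rw [← ha, ← hd]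
    simp

end Br

/-! ### Maximal subfields of division algebras -/

namespace Brauer

variable {F : Type*} [Field F]

/-- Every element of a division algebra lies in a subfield that is its own centralizer. -/
theorem exists_maximal_subfield {D : Type u} [Ring D] [Algebra F D] [FiniteDimensional F D]
    [IsDomain D] (x : D) :
    ∃ (L : Type u) (_ : Field L) (_ : Algebra F L) (_ : FiniteDimensional F L) (j : L →ₐ[F] D),
      x ∈ j.range ∧ ∀ z, (∀ l, Commute (j l) z) → z ∈ j.range := by
  let P : Set (Subalgebra F D) := {S | x ∈ S ∧ ∀ a ∈ S, ∀ b ∈ S, Commute a b}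
  have hadj : ∀ s : Set D, x ∈ s → (∀ a ∈ s, ∀ b ∈ s, Commute a b) → Algebra.adjoin F s ∈ P := by
    intro s hx hs
    refine ⟨Algebra.subset_adjoin hx, fun a ha b hb => ?_⟩
    refine Algebra.commute_of_mem_adjoin_of_forall_mem_commute hb fun c hc => ?_
    exact (Algebra.commute_of_mem_adjoin_of_forall_mem_commute ha fun d hd => hs c hc d hd).symm
  obtain ⟨_, ⟨S, hS, rfl⟩, hmax⟩ := (wellFounded_gt (α := Submodule F D)).has_min
    (Subalgebra.toSubmodule '' P) ⟨_, _, hadj {x} rfl (by simp), rfl⟩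
  -- Otherwise adjoining `z` would give a larger commutative subalgebra containing `x`.
  have hcent : ∀ z, (∀ l ∈ S, Commute l z) → z ∈ S := by
    intro z hz
    have h := hadj (insert z S) (Set.mem_insert_of_mem _ hS.1) (by
      rintro a (rfl | ha) b (rfl | hb)
      · exact Commute.refl _
      · exact (hz b hb).symm
      · exact hz a ha
      · exact hS.2 a ha b hb)
    have hle : S ≤ Algebra.adjoin F (insert z S) := fun l hl =>
      Algebra.subset_adjoin (Set.mem_insert_of_mem _ hl)
    have heq : Subalgebra.toSubmodule S = Subalgebra.toSubmodule (Algebra.adjoin F (insert z S)) :=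
      eq_of_le_of_not_lt hle (hmax _ ⟨_, h, rfl⟩)
    have hzm : z ∈ Subalgebra.toSubmodule (Algebra.adjoin F (insert z (S : Set D))) :=
      Algebra.subset_adjoin (Set.mem_insert _ _)
    rw [← heq] at hzm
    exact hzm
  let f : Field S :=
    { divisionRingOfFiniteDimensional F S with
      mul_comm := fun a b => Subtype.ext (hS.2 a a.2 b b.2) }
  refine ⟨S, f, S.algebra, inferInstanceAs (FiniteDimensional F S), S.val, ⟨⟨x, hS.1⟩, rfl⟩, ?_⟩
  exact fun z hz => ⟨⟨z, hcent z fun l hl => hz ⟨l, hl⟩⟩, rfl⟩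

section

attribute [local instance] TensorProduct.Algebra.module

/-- A self-centralizing subfield `L` of a division algebra `D` has degree the degree of `D`. -/
theorem finrank_maximal_subfield {D L : Type*} [Ring D] [Algebra F D] [FiniteDimensional F D]
    [Algebra.IsCentral F D] [IsSimpleRing D] (hD : ∀ x : D, x ≠ 0 → IsUnit x) [Field L]
    [Algebra F L] [FiniteDimensional F L] [Module L D] [IsScalarTower F L D] (j : L →ₐ[F] D)
    (hj : ∀ (l : L) (d : D), l • d = j l * d)
    (hcent : ∀ z, (∀ l, Commute (j l) z) → z ∈ j.range) {n : ℕ} (hn : n ^ 2 = Module.finrank F D) :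
    Module.finrank F L = n ∧ Module.finrank L D = n := by
  have : SMulCommClass Dᵐᵒᵖ L D := ⟨fun a l d => by
    rw [hj, hj, MulOpposite.smul_eq_mul_unop, MulOpposite.smul_eq_mul_unop, mul_assoc]⟩
  -- `R` acts on `D` by right multiplication by `D` and left multiplication by `L`. The aim is `R ≅
  -- End_L(D)`, from which the degrees follow by counting dimensions.
  let R := Dᵐᵒᵖ ⊗[F] L
  have hR : ∀ (d e : D), (MulOpposite.op d ⊗ₜ[F] (1 : L) : R) • e = e * d := by
    intro d e
    rw [TensorProduct.Algebra.smul_def, one_smul]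
    rfl
  have hR' : ∀ (l : L) (e : D), ((1 : Dᵐᵒᵖ) ⊗ₜ[F] l : R) • e = l • e := by
    intro l e
    rw [TensorProduct.Algebra.smul_def, one_smul]
  have : IsSimpleModule R D := by
    refine (isSimpleModule_iff R D).2 ⟨fun N => ?_⟩
    rw [or_iff_not_imp_left]
    intro hN
    obtain ⟨d, hd, hd0⟩ := N.ne_bot_iff.1 hN
    obtain ⟨u, rfl⟩ := hD d hd0
    refine eq_top_iff.2 fun e _ => ?_
    have := N.smul_mem (MulOpposite.op (↑u⁻¹ * e) ⊗ₜ[F] (1 : L) : R) hd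
    rwa [hR, Units.mul_inv_cancel_left] at this
  -- Commuting with right multiplications makes `f` left multiplication by `f 1`; commuting with `L`
  -- puts `f 1` in the centralizer of `L`, which is `L`.
  have hend : ∀ f : Module.End R D, ∃ l : L, ∀ e, f e = l • e := by
    intro f
    have h1 : ∀ e, f e = f 1 * e := fun e => by
      rw [← hR, ← map_smul, hR, one_mul]
    obtain ⟨l, hl⟩ := hcent (f 1) fun l => by
      have := h1 (j l)
      have h2 : f (j l) = j l * f 1 := by
        rw [← hj, ← hR', ← map_smul, hR', hj, mul_one]
      exact h2.symm.trans this
    refine ⟨l, fun e => ?_⟩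
    rw [h1, hj]
    exact congrArg (· * e) hl.symm
  have : Module.Finite L D := Module.Finite.of_restrictScalars_finite F L D
  let ρ : R →ₐ[F] Module.End L D := Algebra.TensorProduct.lift (Algebra.lsmul F L D)
    (Algebra.lsmul F L D) fun a l => LinearMap.ext fun d => smul_comm a l d
  have hρ : ∀ (r : R) (d : D), ρ r d = r • d := by
    intro r d
    induction r using TensorProduct.induction_on with
    | zero => rw [map_zero]; exact (zero_smul R d).symm
    | tmul a l =>
      rw [TensorProduct.Algebra.smul_def]
      rfl
    | add r s hr hs => rw [map_add, LinearMap.add_apply, hr, hs, add_smul]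
  -- Since `D` is a simple `R`-module with endomorphisms `L`, Jacobson density realizes any
  -- `L`-linear map on a finite `L`-basis.
  have hsurj : Function.Surjective ρ := by
    classical
    intro g
    let g' : Module.End (Module.End R D) D :=
      { toFun := g
        map_add' := map_add g
        map_smul' := fun f d => by
          obtain ⟨l, hl⟩ := hend f
          simp only [Module.End.smul_def, hl, map_smul, RingHom.id_apply] }
    obtain ⟨r, hr⟩ := jacobson_density g' (Finset.univ.image (Module.finBasis L D))
    refine ⟨r, (Module.finBasis L D).ext fun i => ?_⟩
    rw [hρ]
    exact (hr _ (Finset.mem_image_of_mem _ (Finset.mem_univ i))).symm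
  have hinj : Function.Injective ρ := ρ.toRingHom.injective
  have hdim := (LinearEquiv.ofBijective ρ.toLinearMap ⟨hinj, hsurj⟩).finrank_eq
  have hmul := Module.finrank_mul_finrank F L D
  have hend := Module.finrank_mul_finrank F L (Module.End L D)
  rw [← hend, Module.finrank_linearMap, Module.finrank_tensorProduct,
    (MulOpposite.opLinearEquiv F (M := D)).symm.finrank_eq, ← hn] at hdim
  have hL : 0 < Module.finrank F L := Module.finrank_pos
  have hD' : Module.finrank L D = n := by
    have : Module.finrank L D ^ 2 = n ^ 2 := by
      refine Nat.eq_of_mul_eq_mul_left hL ?_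
      rw [sq, ← hdim, mul_comm]
    exact Nat.pow_left_injective two_ne_zero this
  refine ⟨?_, hD'⟩
  have : 0 < Module.finrank L D := Module.finrank_pos
  rw [hD', ← hn, sq] at hmul
  exact Nat.eq_of_mul_eq_mul_right (hD' ▸ this) hmul

end

end Brauer

/-! ### Reduced norms of multiples of a class -/

namespace Br

open Brauer

variable {F : Type u} [Field F]

/-- A reduced norm from the division algebra of class `α` is the norm from a finite extension
that splits `-α`. -/
theorem exists_isSplitBy_neg {α : Br F} {a : Fˣ} (ha : a ∈ nrd α) :
    ∃ (L : Type u) (_ : Field L) (_ : Algebra F L) (_ : FiniteDimensional F L) (y : L),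
      Algebra.norm F y = a ∧ IsSplitBy L (-α) := by
  obtain ⟨D, hD, rfl, x, n, φ, hn, hx⟩ := ha
  have : NoZeroDivisors D := ⟨fun {a b} hab => by
    rw [or_iff_not_imp_left]
    exact fun h => (hD a h).mul_right_eq_zero.1 hab⟩
  have : IsDomain D := NoZeroDivisors.to_isDomain D
  obtain ⟨L, _, _, _, j, ⟨y, rfl⟩, hcent⟩ := exists_maximal_subfield (F := F) x
  let _ : Module L D := Module.compHom D j.toRingHom
  have hj : ∀ (l : L) (d : D), l • d = j l * d := fun _ _ => rfl
  have : IsScalarTower F L D := ⟨fun c l d => by simp [hj]⟩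
  have : Module.Finite L D := Module.Finite.of_restrictScalars_finite F L D
  have : SMulCommClass Dᵐᵒᵖ L D := ⟨fun a l d => by
    rw [hj, hj, MulOpposite.smul_eq_mul_unop, MulOpposite.smul_eq_mul_unop, mul_assoc]⟩
  obtain ⟨hL, hLD⟩ := finrank_maximal_subfield hD j hj hcent hn
  refine ⟨L, _, _, ‹_›, y, ?_, ?_⟩
  · apply (algebraMap F (AlgebraicClosure F)).injective
    rw [← hx]
    exact (det_of_maximal_subfield φ (by simpa using hn) j (by simpa using hL) y).symm
  -- Right multiplication is an `L`-linear action of `Dᵐᵒᵖ` on `D`, of dimension `n` over `L`; the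
  -- opposite algebra is the source of the sign.
  · refine ⟨CSA.opposite D, n, (((algEquivMatrix (Module.finBasisOfFinrankEq L D hLD)).restrictScalars
      F).toAlgHom.comp (Algebra.lsmul F L D) : Dᵐᵒᵖ →ₐ[F] _), rfl, ?_⟩
    exact hn.trans (MulOpposite.opLinearEquiv F (M := D)).finrank_eq

/-- Reduced norms from the class `α` are reduced norms from the multiples of `α`. -/
theorem nrd_subset_nsmul (α : Br F) (m : ℕ) : nrd α ⊆ nrd (m • α) := by
  -- Splitting `-α` only yields multiples of `-α`; a first application with multiplier 1 cancels the
  -- sign.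
  have key : ∀ (α : Br F) (m : ℕ), nrd α ⊆ nrd (m • -α) := by
    intro α m a ha
    obtain ⟨L, _, _, _, y, hy, hL⟩ := exists_isSplitBy_neg ha
    exact (hL.nsmul m).norm_mem_nrd y a hy
  intro a ha
  have := key _ m (key α 1 ha)
  rwa [one_smul, neg_neg] at this

end Br

/-! ### Splitting by finite Galois extensions -/

namespace Brauer

variable {F : Type*} [Field F]

theorem isCentral_baseChange (K : Type*) {A : Type*} [Field K] [Algebra F K] [Ring A] [Algebra F A]
    [Algebra.IsCentral F A] : Algebra.IsCentral K (K ⊗[F] A) where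
  out := by
    intro z hz
    rw [Subalgebra.mem_center_iff] at hz
    have h1 : z ∈ Subalgebra.centralizer F
        ((Algebra.TensorProduct.includeRight : A →ₐ[F] K ⊗[F] A).range : Set (K ⊗[F] A)) := by
      rw [Subalgebra.mem_centralizer_iff]
      exact fun g _ => hz g
    rw [Subalgebra.centralizer_range_includeRight_eq_center_tensorProduct] at h1
    obtain ⟨w, rfl⟩ := h1
    clear hz
    induction w using TensorProduct.induction_on with
    | zero => rw [map_zero]; exact zero_mem _
    | tmul k c =>
      obtain ⟨a, ha⟩ := (Algebra.IsCentral.mem_center_iff F).1 c.2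
      refine Algebra.mem_bot.2 ⟨a • k, ?_⟩
      change (a • k) ⊗ₜ[F] (1 : A) = k ⊗ₜ[F] (c : A)
      rw [ha, Algebra.algebraMap_eq_smul_one, TensorProduct.smul_tmul]
    | add x y hx hy => rw [map_add]; exact add_mem hx hy

/-- Division algebras over a separably closed field are trivial. -/
theorem bijective_algebraMap_of_isSepClosed {K D : Type*} [Field K] [IsSepClosed K]
    [DivisionRing D] [Algebra K D] [FiniteDimensional K D] [Algebra.IsCentral K D] :
    Function.Bijective (algebraMap K D) := by
  refine ⟨(algebraMap K D).injective, ?_⟩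
  by_contra h
  have hne : (⊥ : Subalgebra K D) ≠ ⊤ := fun h' => h fun d =>
    Algebra.mem_bot.1 (h' ▸ Algebra.mem_top : d ∈ (⊥ : Subalgebra K D))
  -- By Jacobson–Noether a larger `D` has a separable element outside `K`; its minimal polynomial is
  -- linear, a contradiction.
  obtain ⟨x, hx, hsep⟩ := JacobsonNoether.exists_separable_and_not_isCentral' hne
  have hint : IsIntegral K x := Algebra.IsIntegral.isIntegral x
  have hdeg := IsSepClosed.degree_eq_one_of_irreducible K (minpoly.irreducible hint) hsep
  exact hx (Algebra.mem_bot.2 (minpoly.mem_range_of_degree_eq_one K x hdeg))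

/-- By Wedderburn the base change is a matrix algebra over a central division `K`-algebra, which is
`K` itself. -/
theorem exists_rep_of_isSepClosed (K : Type*) {A : Type*} [Field K] [IsSepClosed K] [Algebra F K]
    [Ring A] [Algebra F A] [Algebra.IsCentral F A] [IsSimpleRing A] [FiniteDimensional F A] :
    ∃ (n : ℕ) (_ : A →ₐ[F] Matrix (Fin n) (Fin n) K), n ^ 2 = Module.finrank F A := by
  have : IsSimpleRing (K ⊗[F] A) :=
    IsSimpleRing.of_ringEquiv (Algebra.TensorProduct.comm F A K).toRingEquiv inferInstance
  have := isCentral_baseChange (F := F) K (A := A)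
  have : IsArtinianRing (K ⊗[F] A) := IsArtinianRing.of_finite K _
  obtain ⟨s, hs, D, _, _, _, ⟨e⟩⟩ :=
    IsSimpleRing.exists_algEquiv_matrix_divisionRing_finite K (K ⊗[F] A)
  have : Algebra.IsCentral K (Matrix (Fin s) (Fin s) D) := Algebra.IsCentral.of_algEquiv K _ _ e
  have : Algebra.IsCentral K D := isCentral_of_matrix s
  let e' : K ≃ₐ[K] D := AlgEquiv.ofBijective (Algebra.ofId K D) bijective_algebraMap_of_isSepClosed
  let e'' := e.trans e'.symm.mapMatrix
  refine ⟨s, (e''.toAlgHom.restrictScalars F).comp Algebra.TensorProduct.includeRight, ?_⟩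
  have := e''.toLinearEquiv.finrank_eq
  rw [Module.finrank_baseChange, Module.finrank_matrix] at this
  simp [this, sq]

/-- A representation over a Galois extension is defined over a finite Galois subextension. -/
theorem exists_rep_of_finite_isGalois {A Ω : Type*} [Ring A] [Algebra F A] [FiniteDimensional F A]
    [Field Ω] [Algebra F Ω] [IsGalois F Ω] {n : ℕ} (φ : A →ₐ[F] Matrix (Fin n) (Fin n) Ω) :
    ∃ (K : IntermediateField F Ω) (_ : A →ₐ[F] Matrix (Fin n) (Fin n) K),
      FiniteDimensional F K ∧ IsGalois F K := by
  let b := Module.finBasis F A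
  -- The entries of the images of a basis are finitely many and generate a finite extension that
  -- carries `φ`; its normal closure is Galois.
  let S : Set Ω := Set.range fun p : Fin _ × Fin n × Fin n => φ (b p.1) p.2.1 p.2.2
  have : Finite S := Set.finite_range _
  let E := IntermediateField.adjoin F S
  have : FiniteDimensional F E := IntermediateField.finiteDimensional_adjoin
    fun x _ => Algebra.IsIntegral.isIntegral x
  let K := IntermediateField.normalClosure F E Ω
  have hEK : E ≤ K := E.le_normalClosure
  have hφ : ∀ a i k, φ a i k ∈ K := by
    intro a i k
    rw [← b.sum_repr a, map_sum, Matrix.sum_apply]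
    refine sum_mem fun l _ => ?_
    rw [map_smul, Matrix.smul_apply]
    exact K.smul_mem (hEK (IntermediateField.subset_adjoin F S ⟨(l, i, k), rfl⟩))
  have hinj : Function.Injective (K.val.mapMatrix (m := Fin n)) := fun M N h => by
    ext i k
    exact congrFun (congrFun h i) k
  let ψ (a : A) : Matrix (Fin n) (Fin n) K := .of fun i k => ⟨φ a i k, hφ a i k⟩
  have hψ : ∀ a, K.val.mapMatrix (ψ a) = φ a := fun _ => rfl
  refine ⟨K,
    { toFun := ψ
      map_one' := hinj (by rw [hψ, map_one, map_one])
      map_zero' := hinj (by rw [hψ, map_zero, map_zero])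
      map_mul' := fun a a' => hinj (by rw [map_mul, hψ, hψ, hψ, map_mul])
      map_add' := fun a a' => hinj (by rw [map_add, hψ, hψ, hψ, map_add])
      commutes' := fun c => hinj (by rw [hψ, AlgHom.commutes, AlgHom.commutes]) },
    inferInstance, { }⟩

theorem exists_rep_of_isGalois {F : Type u} [Field F] (A : Type*) [Ring A] [Algebra F A]
    [Algebra.IsCentral F A] [IsSimpleRing A] [FiniteDimensional F A] :
    ∃ (K : Type u) (_ : Field K) (_ : Algebra F K) (_ : FiniteDimensional F K) (_ : IsGalois F K)
      (n : ℕ) (_ : A →ₐ[F] Matrix (Fin n) (Fin n) K), n ^ 2 = Module.finrank F A := by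
  obtain ⟨n, φ, hn⟩ := exists_rep_of_isSepClosed (F := F) (SeparableClosure F) (A := A)
  obtain ⟨K, ψ, _, _⟩ := exists_rep_of_finite_isGalois φ
  exact ⟨K, inferInstance, inferInstance, ‹_›, ‹_›, n, ψ, hn⟩

end Brauer

/-! ### Skolem–Noether and Galois descent -/

namespace Brauer

variable {F : Type*} [Field F]

theorem bijective_of_finrank_eq {A B : Type*} [Ring A] [Ring B] [Algebra F A] [Algebra F B]
    [FiniteDimensional F A] [FiniteDimensional F B] (f : A →ₐ[F] B) (hf : Function.Injective f)
    (h : Module.finrank F A = Module.finrank F B) : Function.Bijective f :=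
  ⟨hf, (LinearMap.injective_iff_surjective_of_finrank_eq_finrank (f := f.toLinearMap) h).1 hf⟩

/-- Two representations of a central simple algebra over an extension field, of dimension the
degree of the algebra, are conjugate. -/
theorem exists_conj {A K ι : Type*} [Ring A] [Algebra F A] [Algebra.IsCentral F A]
    [IsSimpleRing A] [FiniteDimensional F A] [Field K] [Algebra F K] [Fintype ι] [DecidableEq ι]
    (φ ψ : A →ₐ[F] Matrix ι ι K) (h : Fintype.card ι ^ 2 = Module.finrank F A) :
    ∃ u : GL ι K, ∀ a, u.1 * ψ a = φ a * u.1 := by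
  let e := AlgEquiv.ofBijective _ (bijective_baseChangeRep φ h)
  let e' := AlgEquiv.ofBijective _ (bijective_baseChangeRep ψ h)
  let t : Matrix ι ι K ≃ₐ[K] Module.End K (ι → K) := Matrix.toLinAlgEquiv'
  -- The map `ψ a ↦ φ a` extends to an automorphism of the endomorphism algebra of `Kⁿ`, which is
  -- conjugation by some `T`.
  obtain ⟨T, hT⟩ := (t.symm.trans <| e'.symm.trans <| e.trans t).eq_linearEquivConjAlgEquiv
  let u : GL ι K := Units.map t.symm.toAlgHom.toMonoidHom
    ⟨T.toLinearMap, T.symm.toLinearMap, by ext; simp, by ext; simp⟩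
  refine ⟨u, fun a => ?_⟩
  have hu : t u.1 = T.toLinearMap := t.apply_symm_apply _
  apply t.injective
  rw [map_mul, map_mul, hu]
  have h1 := AlgEquiv.congr_fun hT (t (ψ a))
  have h2 : e'.symm (ψ a) = 1 ⊗ₜ a := by
    rw [AlgEquiv.symm_apply_eq]
    exact (baseChangeRep_one_tmul ψ a).symm
  have h3 : e (1 ⊗ₜ a) = φ a := baseChangeRep_one_tmul φ a
  simp only [AlgEquiv.trans_apply, AlgEquiv.symm_apply_apply, h2, h3] at h1
  rw [h1]
  ext w
  simp

/-- A matrix that commutes with the image of a representation as in `exists_conj` is a scalar. -/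
theorem exists_scalar_of_commute {A K ι : Type*} [Ring A] [Algebra F A] [Algebra.IsCentral F A]
    [IsSimpleRing A] [FiniteDimensional F A] [Field K] [Algebra F K] [Fintype ι] [DecidableEq ι]
    (φ : A →ₐ[F] Matrix ι ι K) (h : Fintype.card ι ^ 2 = Module.finrank F A) (M : Matrix ι ι K)
    (hM : ∀ a, M * φ a = φ a * M) : ∃ c : K, M = c • 1 := by
  have hcomm : ∀ N, N * M = M * N := by
    intro N
    obtain ⟨x, rfl⟩ := (bijective_baseChangeRep φ h).2 N
    induction x using TensorProduct.induction_on with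
    | zero => simp
    | tmul k a =>
      have : k ⊗ₜ[F] a = k • ((1 : K) ⊗ₜ[F] a) := by simp [TensorProduct.smul_tmul']
      rw [this, map_smul, baseChangeRep_one_tmul, Matrix.smul_mul, Matrix.mul_smul, hM]
    | add x y hx hy => rw [map_add, add_mul, mul_add, hx, hy]
  obtain ⟨c, hc⟩ := (Algebra.IsCentral.mem_center_iff K).1 (Subalgebra.mem_center_iff.2 hcomm)
  exact ⟨c, by rw [hc, Algebra.algebraMap_eq_smul_one]⟩

section Descent

variable {K ι : Type*} [Field K] [Algebra F K] [Fintype ι] [DecidableEq ι]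

/-- The `F`-subspace of `Kⁿ` of the vectors that are fixed by the twisted Galois action
`w ↦ u σ * σ w`. -/
def descent (u : Gal(K/F) → GL ι K) : Submodule F (ι → K) where
  carrier := {w | ∀ σ, (u σ).1.mulVec (σ ∘ w) = w}
  zero_mem' σ := by
    have : σ ∘ (0 : ι → K) = 0 := by ext; simp
    rw [this, Matrix.mulVec_zero]
  add_mem' {v w} hv hw σ := by
    have : σ ∘ (v + w) = σ ∘ v + σ ∘ w := by ext; simp
    rw [this, Matrix.mulVec_add, hv, hw]
  smul_mem' c w hw σ := by
    have : σ ∘ (c • w) = c • (σ ∘ w) := by ext; simp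
    rw [this, Matrix.mulVec_smul, hw]

variable [FiniteDimensional F K] (u : Gal(K/F) → GL ι K)

/-- The averages `∑ u σ (σ (c eᵢ))` are fixed. If they all vanished, Dedekind's independence of
automorphisms would make the `i`-th column of the invertible matrix `u 1` zero. -/
theorem descent_ne_bot [Nonempty ι]
    (hu : ∀ σ τ, (u σ).1 * (u τ).1.map σ = (u (σ * τ)).1) : descent u ≠ ⊥ := by
  classical
  intro hbot
  obtain ⟨i⟩ := ‹Nonempty ι›
  let w (c : K) : ι → K := ∑ σ : Gal(K/F), (u σ).1.mulVec (σ ∘ Pi.single i c)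
  have hw : ∀ c, w c ∈ descent u := by
    intro c τ
    have : τ ∘ w c = ∑ σ : Gal(K/F), ((u σ).1.map τ).mulVec ((τ * σ) ∘ Pi.single i c) := by
      ext k
      simp [w, Matrix.mulVec, dotProduct]
    rw [this, Matrix.mulVec_sum]
    simp only [Matrix.mulVec_mulVec, hu]
    exact Fintype.sum_equiv (Equiv.mulLeft τ) _ _ fun σ => rfl
  have h0 : ∀ c k, ∑ σ : Gal(K/F), (u σ).1 k i * σ c = 0 := by
    intro c k
    have h1 : w c = 0 := by simpa [hbot] using hw c
    have h2 := congrFun h1 k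
    have h3 : ∀ σ : Gal(K/F), σ ∘ Pi.single i c = Pi.single i (σ c) := by
      intro σ
      ext l
      rcases eq_or_ne l i with rfl | hl
      · simp
      · simp [hl]
    simpa [w, h3, Matrix.mulVec_single] using h2
  have hind := (linearIndependent_monoidHom K K).comp
    (fun σ : Gal(K/F) => (σ : K →* K)) fun σ τ h => by
      ext x
      exact DFunLike.congr_fun h x
  have hcol : ∀ k, (u 1).1 k i = 0 := by
    intro k
    refine Fintype.linearIndependent_iff.1 hind (fun σ => (u σ).1 k i) ?_ 1
    ext c
    simpa using h0 c k
  have h1 : (u 1).1.mulVec (Pi.single i 1) = 0 := by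
    ext k
    simpa [Matrix.mulVec_single] using hcol k
  have h2 := congrArg ((u 1)⁻¹.1.mulVec) h1
  rw [Matrix.mulVec_mulVec, Matrix.mulVec_zero, Units.inv_mul, Matrix.one_mulVec] at h2
  simpa using congrFun h2 i

/-- Fixed vectors independent over `F` stay independent over `K`: scale a `K`-relation by `c`, apply
the twisted action and sum over the group to get an `F`-relation whose coefficients are traces. -/
theorem finrank_descent_le [IsGalois F K] :
    Module.finrank F (descent u) ≤ Fintype.card ι := by
  classical
  let b := Module.finBasis F (descent u)
  have hli : LinearIndependent K fun l => (b l : ι → K) := by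
    rw [Fintype.linearIndependent_iff]
    intro g hg l
    by_contra hl
    have h1 : ∀ c : K, ∑ m, Algebra.trace F K (c * g m) • b m = 0 := by
      intro c
      apply Subtype.ext
      have h2 : ∀ σ : Gal(K/F), ∑ m, σ (c * g m) • (b m : ι → K) = 0 := by
        intro σ
        have h3 : σ ∘ (∑ m, (c * g m) • (b m : ι → K)) = ∑ m, σ (c * g m) • (σ ∘ (b m : ι → K)) := by
          ext k
          simp
        have h4 : ∑ m, (c * g m) • (b m : ι → K) = 0 := by
          simp_rw [mul_smul]
          rw [← Finset.smul_sum, hg, smul_zero]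
        have h5 := congrArg ((u σ).1.mulVec) h3
        rw [h4, Matrix.mulVec_sum] at h5
        simp only [Matrix.mulVec_smul, (b _).2 σ] at h5
        rw [← h5]
        have : σ ∘ (0 : ι → K) = 0 := by ext; simp
        rw [this, Matrix.mulVec_zero]
      have h6 : ∀ m, Algebra.trace F K (c * g m) • (b m : ι → K) =
          ∑ σ : Gal(K/F), σ (c * g m) • (b m : ι → K) := by
        intro m
        rw [← Finset.sum_smul, ← trace_eq_sum_automorphisms, algebraMap_smul]
      simp only [Submodule.coe_sum, Submodule.coe_smul, h6]
      rw [Finset.sum_comm]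
      simp only [h2, Finset.sum_const_zero, Submodule.coe_zero]
    -- Scaling by `c / g l` makes the `l`-th coefficient the trace of `c`, which is 1.
    obtain ⟨c, hc⟩ := Algebra.trace_surjective F K 1
    have := Fintype.linearIndependent_iff.1 b.linearIndependent _ (h1 (c / g l)) l
    rw [div_mul_cancel₀ _ hl, hc] at this
    exact one_ne_zero this
  simpa using hli.fintype_card_le_finrank

/-- Galois descent: a representation that is isomorphic to its conjugates by way of a cocycle
with values in `GLₙ(K)` comes from an isomorphism with `Mₙ(F)`. -/
theorem nonempty_algEquiv_matrix [IsGalois F K] {A : Type*} [Ring A] [Algebra F A]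
    [IsSimpleRing A] [FiniteDimensional F A] (φ : A →ₐ[F] Matrix ι ι K)
    (h : Fintype.card ι ^ 2 = Module.finrank F A)
    (hφ : ∀ (σ : Gal(K/F)) (x : A), (u σ).1 * (φ x).map σ = φ x * (u σ).1)
    (hu : ∀ σ τ, (u σ).1 * (u τ).1.map σ = (u (σ * τ)).1) :
    Nonempty (A ≃ₐ[F] Matrix (Fin (Fintype.card ι)) (Fin (Fintype.card ι)) F) := by
  have hpos : 0 < Module.finrank F A := Module.finrank_pos
  have : Nonempty ι := by
    rw [← Fintype.card_pos_iff]
    refine Nat.pos_of_ne_zero fun h0 => ?_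
    rw [h0] at h
    omega
  let V := descent u
  have : Nontrivial V := Submodule.nontrivial_iff_ne_bot.2 (descent_ne_bot u hu)
  have hmem : ∀ a, ∀ w ∈ V, (φ a).mulVec w ∈ V := by
    intro a w hw σ
    have : σ ∘ ((φ a).mulVec w) = ((φ a).map σ).mulVec (σ ∘ w) := by
      ext k
      simp [Matrix.mulVec, dotProduct]
    rw [this, Matrix.mulVec_mulVec, hφ, ← Matrix.mulVec_mulVec, hw σ]
  let ρ : A →ₐ[F] Module.End F V :=
    { toFun := fun a => ((φ a).mulVecLin.restrictScalars F).restrict (hmem a)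
      map_one' := by ext w; simp
      map_zero' := by ext w; simp
      map_mul' := fun a b => LinearMap.ext fun w => Subtype.ext <| by
        change (φ (a * b)).mulVec w = (φ a).mulVec ((φ b).mulVec w)
        rw [map_mul, Matrix.mulVec_mulVec]
      map_add' := fun a b => LinearMap.ext fun w => Subtype.ext <| by
        change (φ (a + b)).mulVec w = (φ a).mulVec w + (φ b).mulVec w
        rw [map_add, Matrix.add_mulVec]
      commutes' := fun c => by
        ext w
        simp [Algebra.algebraMap_eq_smul_one] }
  have hinj : Function.Injective ρ := ρ.toRingHom.injective
  have hle := LinearMap.finrank_le_finrank_of_injective (f := ρ.toLinearMap) hinj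
  -- The simple algebra `A` acts faithfully on `V ≠ 0`, which bounds the dimension of `V` below;
  -- descent bounds it above.
  have hV : Module.finrank F V = Fintype.card ι := by
    refine le_antisymm (finrank_descent_le u) ?_
    rw [← h, Module.finrank_linearMap, ← sq] at hle
    exact (Nat.pow_le_pow_iff_left two_ne_zero).1 hle
  have hdim : Module.finrank F A = Module.finrank F (Module.End F V) := by
    rw [Module.finrank_linearMap, hV, ← h, sq]
  have hbij := bijective_of_finrank_eq (F := F) (A := A) (B := Module.End F V) ρ hinj hdim
  exact ⟨(AlgEquiv.ofBijective ρ hbij).trans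
    (algEquivMatrix (Module.finBasisOfFinrankEq F V hV))⟩

end Descent

end Brauer

/-! ### Cocycles of Brauer classes and torsion -/

namespace Br

open Brauer GaloisModule

variable {F : Type u} [Field F] {K : Type u} [Field K] [Algebra F K]

theorem isBrauerCocycle_zero : IsBrauerCocycle (0 : Br F) (0 : (Fin 2 → Gal(K/F)) → Additive Kˣ) := by
  refine ⟨CSA.base F, 1, Algebra.ofId F (Matrix (Fin 1) (Fin 1) K), fun _ => 1, rfl, ?_,
    IsLocallyConstant.const 1, fun σ x => ?_, fun σ τ => ?_⟩
  · rw [one_pow]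
    exact (Module.finrank_self F).symm
  · rw [Units.val_one, one_mul, mul_one]
    exact AlgHom.commutes (σ.toAlgHom.mapMatrix (m := Fin 1)) x
  · simp

/-- Take Kronecker products of the splittings and of the comparison matrices; the scalars multiply.
-/
theorem IsBrauerCocycle.add {α β : Br F} {f g : (Fin 2 → Gal(K/F)) → Additive Kˣ}
    (hf : IsBrauerCocycle α f) (hg : IsBrauerCocycle β g) : IsBrauerCocycle (α + β) (f + g) := by
  obtain ⟨A, n, φ, u, rfl, hA, hu, hφu, hfu⟩ := hf
  obtain ⟨B, m, ψ, v, rfl, hB, hv, hψv, hgv⟩ := hg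
  let R := Matrix.reindexAlgEquiv F K (finProdFinEquiv (m := n) (n := m))
  have hR : ∀ (σ : Gal(K/F)) M, (R M).map σ = R (M.map σ) := fun _ _ => rfl
  have hmap : ∀ (σ : Gal(K/F)) (M : Matrix (Fin n) (Fin n) K) (N : Matrix (Fin m) (Fin m) K),
      (Matrix.kronecker M N).map σ = Matrix.kronecker (M.map σ) (N.map σ) := by
    intro σ M N
    ext i j
    simp
  have hmul : ∀ (M M' : Matrix (Fin n) (Fin n) K) (N N' : Matrix (Fin m) (Fin m) K),
      Matrix.kronecker M N * Matrix.kronecker M' N' = Matrix.kronecker (M * M') (N * N') :=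
    fun M M' N N' => (Matrix.mul_kronecker_mul M M' N N').symm
  let w (a : GL (Fin n) K) (b : GL (Fin m) K) : GL (Fin (n * m)) K :=
    ⟨R (Matrix.kronecker a.1 b.1), R (Matrix.kronecker a⁻¹.1 b⁻¹.1),
      by rw [← map_mul, hmul, Units.mul_inv, Units.mul_inv, Matrix.kronecker,
        Matrix.one_kronecker_one, map_one],
      by rw [← map_mul, hmul, Units.inv_mul, Units.inv_mul, Matrix.kronecker,
        Matrix.one_kronecker_one, map_one]⟩
  refine ⟨CSA.tensor A B, n * m, (R.toAlgHom.comp (kroneckerRep φ ψ) : A ⊗[F] B →ₐ[F] _),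
    fun σ => w (u σ) (v σ), rfl, ?_, hu.comp₂ hv w, ?_, fun σ τ => ?_⟩
  · rw [mul_pow, hA, hB]
    exact (Module.finrank_tensorProduct (R := F) (S := F) (M := A) (M' := B)).symm
  · intro σ x
    change R (Matrix.kronecker (u σ).1 (v σ).1) * (R (kroneckerRep φ ψ x)).map σ =
      R (kroneckerRep φ ψ x) * R (Matrix.kronecker (u σ).1 (v σ).1)
    rw [hR, ← map_mul, ← map_mul]
    congr 1
    change A ⊗[F] B at x
    induction x using TensorProduct.induction_on with
    | zero => simp
    | tmul a b => rw [kroneckerRep_tmul, hmap, hmul, hmul, hφu, hψv]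
    | add x y hx hy =>
      rw [map_add, add_mul, ← hx, ← hy, ← mul_add]
      congr 1
      ext i j
      simp
  · change R (Matrix.kronecker (u σ).1 (v σ).1) * (R (Matrix.kronecker (u τ).1 (v τ).1)).map σ =
      (((f ![σ, τ]).toMul : K) * (g ![σ, τ]).toMul) •
        R (Matrix.kronecker (u (σ * τ)).1 (v (σ * τ)).1)
    rw [hR, ← map_mul, hmap, hmul, hfu, hgv]
    ext i j
    simp [R]
    ring

theorem IsBrauerCocycle.nsmul {α : Br F} {f : (Fin 2 → Gal(K/F)) → Additive Kˣ}
    (hf : IsBrauerCocycle α f) (k : ℕ) : IsBrauerCocycle (k • α) (k • f) := by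
  induction k with
  | zero => rw [zero_smul, zero_smul]; exact isBrauerCocycle_zero
  | succ k ih => rw [succ_nsmul, succ_nsmul]; exact ih.add hf

/-- A Brauer class with a cocycle that is a coboundary is trivial. -/
theorem IsBrauerCocycle.eq_zero [FiniteDimensional F K] [IsGalois F K] {α : Br F}
    {f : (Fin 2 → Gal(K/F)) → Additive Kˣ} (hf : IsBrauerCocycle α f) (c : Gal(K/F) → Kˣ)
    (hc : ∀ σ τ, (c σ : K) * σ (c τ) = ((f ![σ, τ]).toMul : K) * c (σ * τ)) : α = 0 := by
  obtain ⟨A, n, φ, u, rfl, hA, -, hφu, hfu⟩ := hf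
  let s (x : Kˣ) : GL (Fin n) K := Units.map (algebraMap K (Matrix (Fin n) (Fin n) K)).toMonoidHom x
  have hs : ∀ x M, (s x).1 * M = (x : K) • M := fun x M => (Algebra.smul_def _ _).symm
  -- Dividing `u σ` by `c σ` turns it into a genuine cocycle in `GLₙ`, so descent applies.
  have hw : ∀ σ, ((s (c σ)⁻¹ * u σ : GL (Fin n) K)).1 = ((c σ)⁻¹ : Kˣ).1 • (u σ).1 := fun σ => by
    rw [Units.val_mul, hs]
  obtain ⟨e⟩ := nonempty_algEquiv_matrix (fun σ => s (c σ)⁻¹ * u σ) φ (by simpa using hA)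
    (fun σ x => by rw [hw, Matrix.smul_mul, Matrix.mul_smul, hφu])
    (fun σ τ => by
      rw [hw, hw, hw]
      have : (((c τ)⁻¹ : Kˣ).1 • (u τ).1).map σ = σ ((c τ)⁻¹ : Kˣ).1 • (u τ).1.map σ := by
        ext i j
        simp
      rw [this, Matrix.smul_mul, Matrix.mul_smul, hfu, smul_smul, smul_smul]
      congr 1
      have h := hc σ τ
      have h1 : σ (c τ) ≠ 0 := by simp
      simp only [Units.val_inv_eq_inv_val, map_inv₀]
      field_simp
      rw [h])
  rw [Fintype.card_fin] at e
  have hn : n ≠ 0 := by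
    rintro rfl
    have : 0 < Module.finrank F A := Module.finrank_pos
    omega
  exact mk_eq_mk.2 (equivalent_base_of_algEquiv hn e)

/-- The Brauer group is a torsion group. -/
theorem exists_nsmul_eq_zero (α : Br F) : ∃ n : ℕ, 0 < n ∧ n • α = 0 := by
  obtain ⟨A, rfl⟩ := mk_surjective α
  obtain ⟨K, _, _, _, _, n, φ, hn⟩ := exists_rep_of_isGalois (F := F) A
  have hn0 : n ≠ 0 := by
    rintro rfl
    have : 0 < Module.finrank F A := Module.finrank_pos
    omega
  refine ⟨n, Nat.pos_of_ne_zero hn0, ?_⟩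
  have hn' : Fintype.card (Fin n) ^ 2 = Module.finrank F A := by simpa using hn
  choose u hu using fun σ : Gal(K/F) => exists_conj φ (σ.toAlgHom.mapMatrix.comp φ) hn'
  replace hu : ∀ (σ : Gal(K/F)) (x : A), (u σ).1 * (φ x).map σ = φ x * (u σ).1 := hu
  have hmap : ∀ (σ : Gal(K/F)) (M N : Matrix (Fin n) (Fin n) K),
      (M * N).map σ = M.map σ * N.map σ := fun σ M N => Matrix.map_mul
  -- Both matrices intertwine `φ` with its conjugate by `σ * τ`, so they differ by a scalar, nonzero
  -- by determinants.
  have hscal : ∀ σ τ : Gal(K/F), ∃ c : Kˣ,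
      (u σ).1 * (u τ).1.map σ = (c : K) • (u (σ * τ)).1 := by
    intro σ τ
    let M := (u σ).1 * (u τ).1.map σ
    have hM : ∀ x, M * (φ x).map (σ * τ) = φ x * M := by
      intro x
      have : (φ x).map (σ * τ) = ((φ x).map τ).map σ := rfl
      rw [this, Matrix.mul_assoc, ← hmap, hu, hmap, ← Matrix.mul_assoc, hu, Matrix.mul_assoc]
    obtain ⟨c, hc⟩ := exists_scalar_of_commute φ hn' (M * (u (σ * τ))⁻¹.1) fun x => by
      have h1 : (u (σ * τ))⁻¹.1 * φ x = (φ x).map (σ * τ) * (u (σ * τ))⁻¹.1 := by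
        rw [Units.inv_mul_eq_iff_eq_mul, ← mul_assoc, hu, Units.mul_inv_cancel_right]
      rw [mul_assoc, h1, ← mul_assoc, hM, mul_assoc]
    have hc' : M = c • (u (σ * τ)).1 := by
      rw [Units.mul_inv_eq_iff_eq_mul] at hc
      rw [hc, Matrix.smul_mul, one_mul]
    have hdet : M.det ≠ 0 := by
      rw [Matrix.det_mul]
      refine mul_ne_zero ((Matrix.isUnit_iff_isUnit_det _).1 (u σ).isUnit).ne_zero ?_
      have : ((u τ).1.map σ).det = σ (u τ).1.det := (σ.toRingHom.map_det (u τ).1).symm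
      rw [this]
      simpa using ((Matrix.isUnit_iff_isUnit_det _).1 (u τ).isUnit).ne_zero
    have hc0 : c ≠ 0 := by
      rintro rfl
      have : Nonempty (Fin n) := ⟨⟨0, Nat.pos_of_ne_zero hn0⟩⟩
      rw [hc', zero_smul, Matrix.det_zero] at hdet
      exact hdet rfl
    exact ⟨Units.mk0 c hc0, hc'⟩
  choose c hc using hscal
  have hcocycle : IsBrauerCocycle (mk A) fun g : Fin 2 → Gal(K/F) => Additive.ofMul (c (g 0) (g 1)) :=
    ⟨A, n, φ, u, rfl, hn, IsLocallyConstant.of_discrete u, hu, hc⟩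
  -- Determinants of `u σ · σ(u τ) = c u(στ)` exhibit the `n`-th power of `c` as the coboundary of
  -- `det u`.
  refine (hcocycle.nsmul n).eq_zero (fun σ => Matrix.GeneralLinearGroup.det (u σ)) fun σ τ => ?_
  have h := congrArg Matrix.det (hc σ τ)
  have hdet : ((u τ).1.map σ).det = σ (u τ).1.det := (σ.toRingHom.map_det (u τ).1).symm
  rw [Matrix.det_mul, Matrix.det_smul, Fintype.card_fin, hdet] at h
  simpa using h

end Br

/-! ### Primary components and the comparison of Suslin groups -/

namespace Br

open Brauer DiscreteCohomology GaloisModule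

variable {F : Type u} [Field F]

theorem nrd_zero : nrd (0 : Br F) = Set.univ := by
  refine Set.eq_univ_of_forall fun a => ⟨CSA.base F, fun x hx => ?_, rfl, (a : F), 1,
    Algebra.ofId F (Matrix (Fin 1) (Fin 1) (AlgebraicClosure F)), ?_, ?_⟩
  · exact (isUnit_iff_ne_zero (G₀ := F) (a := x)).2 hx
  · rw [one_pow]
    exact (Module.finrank_self F).symm
  · rw [Matrix.det_fin_one]
    change algebraMap F (Matrix (Fin 1) (Fin 1) (AlgebraicClosure F)) a 0 0 = _
    simp [Matrix.algebraMap_matrix_apply]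

/-- Cup products with the trivial Brauer class vanish. -/
theorem primaryRostKernel_zero (ℓ : ℕ) : primaryRostKernel ℓ (0 : Br F) = Set.univ := by
  refine Set.eq_univ_of_forall fun a => ?_
  by_cases hℓ : (ℓ : F) = 0
  -- Take level `r = 0`, where the coefficients `K₂/1` vanish.
  · refine Or.inr ⟨hℓ, 0, 0, 0, by simp, isBrauerCocycle_zero, ?_⟩
    have : Subsingleton (MilnorK2Mod (SeparableClosure F) (ℓ ^ 0)) := by
      refine ⟨fun x y => ?_⟩
      obtain ⟨s, rfl⟩ := QuotientAddGroup.mk_surjective x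
      obtain ⟨t, rfl⟩ := QuotientAddGroup.mk_surjective y
      exact QuotientAddGroup.eq.2 (AddSubgroup.subset_closure (Or.inr ⟨-s + t, by simp⟩))
    have : symbolCocycle (L := SeparableClosure F) (ℓ ^ 0) 0 0 (by simp) a = 0 :=
      Subtype.ext (Subsingleton.elim _ _)
    rw [this, map_zero]
  -- Again level `r = 0`: `a` is its own first root and `μ₁` is trivial.
  · refine Or.inl ⟨hℓ, 0, 0, toTop a, by simp, ?_, ?_⟩
    · convert isBrauerCocycle_zero using 1
      exact funext fun g => map_zero (muIncl (SeparableClosure F) (ℓ ^ 0))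
    · have : Subsingleton (Additive (rootsOfUnity (ℓ ^ 0) (SeparableClosure F))) := by
        rw [pow_zero]
        infer_instance
      have : Subsingleton (Additive (rootsOfUnity (ℓ ^ 0) (SeparableClosure F)) ⊗[ℤ]
          Additive (rootsOfUnity (ℓ ^ 0) (SeparableClosure F))) := inferInstance
      rw [show cup (isDiscrete_muRep (F := F) (ℓ ^ 0)) 0
        (kummerCocycle (toTop a) (by simp)) = 0 from Subtype.ext (Subsingleton.elim _ _), map_zero]

/-- The `ℓ`-primary component of a Brauer class is unique. -/
theorem IsPrimaryPart.eq {ℓ : ℕ} {α β γ : Br F} (hβ : IsPrimaryPart ℓ α β)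
    (hγ : IsPrimaryPart ℓ α γ) : β = γ := by
  obtain ⟨⟨k, hk⟩, m, hm, hm'⟩ := hβ
  obtain ⟨⟨k', hk'⟩, m', hm2, hm2'⟩ := hγ
  have h1 : ℓ ^ (k + k') • (β - γ) = 0 := by
    rw [smul_sub, pow_add, mul_smul, mul_smul, hk', smul_comm, hk, smul_zero, smul_zero, sub_zero]
  have h2 : (m * m') • (β - γ) = 0 := by
    have : β - γ = (α - γ) - (α - β) := by abel
    rw [this, smul_sub, mul_smul, hm2', mul_comm, mul_smul, hm']
    simp
  have hcop : Nat.Coprime (ℓ ^ (k + k')) (m * m') :=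
    (Nat.Coprime.mul_left hm hm2).symm.pow_left _
  have h3 := Nat.dvd_gcd (addOrderOf_dvd_of_nsmul_eq_zero h1) (addOrderOf_dvd_of_nsmul_eq_zero h2)
  rw [hcop] at h3
  exact sub_eq_zero.1 (AddMonoid.addOrderOf_eq_one_iff.1 (Nat.dvd_one.1 h3))

/-- If `α` is killed by `ℓᵏM`, with `M` prime to `ℓ`, then its `ℓ`-primary component is a multiple
of `α` killed by `ℓᵏ`. -/
theorem exists_isPrimaryPart {ℓ k M : ℕ} (hM : M.Coprime ℓ) {α : Br F}
    (hα : (ℓ ^ k * M) • α = 0) :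
    ∃ c : ℕ, IsPrimaryPart ℓ α (c • α) ∧ ℓ ^ k • c • α = 0 ∧ M • (α - c • α) = 0 := by
  -- Choose `c ≡ 1` modulo `ℓᵏ` and `c ≡ 0` modulo `M`: multiplication by `c` projects to the
  -- `ℓ`-part.
  obtain ⟨c, hc1, hc2⟩ := Nat.chineseRemainder (hM.symm.pow_left k) 1 0
  have h1 : ℓ ^ k • c • α = 0 := by
    obtain ⟨t, rfl⟩ := (Nat.modEq_zero_iff_dvd.1 hc2)
    rw [← mul_smul, ← mul_assoc, mul_comm, mul_smul, hα, smul_zero]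
  have h2 : M • (α - c • α) = 0 := by
    obtain ⟨t, ht⟩ := (Nat.modEq_iff_dvd.1 hc1)
    have : (M : ℤ) * (1 - c) = t * ((ℓ ^ k * M : ℕ) : ℤ) := by
      have : (1 - c : ℤ) = ℓ ^ k * t := by exact_mod_cast ht
      rw [this]
      push_cast
      ring
    have h3 : α - c • α = (1 - c : ℤ) • α := by rw [sub_smul, one_smul, natCast_zsmul]
    rw [h3, ← natCast_zsmul, ← mul_smul, this, mul_smul, natCast_zsmul, hα, smul_zero]
  exact ⟨c, ⟨⟨k, h1⟩, M, hM, h2⟩, h1, h2⟩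

/-- The Suslin group of a class is contained in that of its primary components. -/
theorem suslinGroup_le_primarySuslinGroup {ℓ k c : ℕ} (hℓ : ℓ.Prime) {α : Br F}
    (hk : ℓ ^ k • c • α = 0) : suslinGroup α ≤ primarySuslinGroup ℓ k (c • α) := by
  refine (Subgroup.closure_le _).2 ?_
  rintro _ ⟨i, hi, b, hb, rfl⟩
  obtain ⟨j, m, hm, rfl⟩ := Nat.exists_eq_pow_mul_and_not_dvd (by omega : i ≠ 0) ℓ hℓ.ne_one
  have hcop : Nat.Coprime (ℓ ^ k) m := ((Nat.Prime.coprime_iff_not_dvd hℓ).2 hm).pow_left k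
  -- This yields `s` inverting `m` modulo `ℓᵏ`, so `m * s` fixes `c • α`, and the multiple `s * c`
  -- of `(ℓ ^ j * m) • α` is `ℓ ^ j • c • α`.
  obtain ⟨t, ht1, ht2⟩ := Nat.chineseRemainder hcop 1 0
  obtain ⟨s, rfl⟩ := Nat.modEq_zero_iff_dvd.1 ht2
  have hb' : b ∈ nrd (ℓ ^ j • c • α) := by
    have h := nrd_subset_nsmul _ (s * c) hb
    have h1 : (m * s) • (c • α) = c • α := by
      obtain ⟨q, hq⟩ := Nat.modEq_iff_dvd.1 ht1
      have : ((m * s : ℕ) : ℤ) = 1 - q * ((ℓ ^ k : ℕ) : ℤ) := by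
        rw [mul_comm q, ← hq, Nat.cast_one, sub_sub_cancel]
      rw [← natCast_zsmul, this, sub_smul, one_smul, mul_smul, natCast_zsmul, hk, smul_zero,
        sub_zero]
    have h2 : (s * c) • (ℓ ^ j * m) • α = ℓ ^ j • c • α := by
      rw [← h1]
      simp only [← mul_smul]
      congr 1
      ring
    rwa [h2] at h
  rw [pow_mul]
  refine pow_mem ?_ m
  rcases le_or_gt j k with hjk | hjk
  · exact Subgroup.subset_closure ⟨j, hjk, b, hb', rfl⟩
  -- The primary group has generators only up to exponent `k`. There the class is zero, all units
  -- are reduced norms, and the excess power goes into the base.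
  · refine Subgroup.subset_closure ⟨k, le_rfl, b ^ ℓ ^ (j - k), ?_, ?_⟩
    · rw [hk, nrd_zero]
      trivial
    · rw [← pow_mul, ← pow_add, Nat.sub_add_cancel hjk.le]

/-- The `M`-th powers of the elements of the Suslin group of a primary component lie in the Suslin
group of the class, if `M` kills the other components. -/
theorem pow_mem_suslinGroup {ℓ k M : ℕ} (hℓ : 0 < ℓ) (hM0 : 0 < M) {α β : Br F}
    (hM : M • (α - β) = 0) {a : Fˣ} (ha : a ∈ primarySuslinGroup ℓ k β) :
    a ^ M ∈ suslinGroup α := by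
  have hle : primarySuslinGroup ℓ k β ≤ (suslinGroup α).comap (powMonoidHom M) := by
    refine (Subgroup.closure_le _).2 ?_
    rintro _ ⟨i, -, b, hb, rfl⟩
    -- `Nrd(ℓⁱβ) ⊆ Nrd(Mℓⁱβ)`, and `Mβ = Mα`.
    refine Subgroup.subset_closure ⟨ℓ ^ i * M, Nat.mul_pos (pow_pos hℓ i) hM0, b, ?_, ?_⟩
    · have h := nrd_subset_nsmul _ M hb
      rw [smul_sub, sub_eq_zero] at hM
      rwa [smul_comm, ← hM, smul_smul] at h
    · simp [pow_mul]
  exact hle ha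

/-- An element of a group lies in a subgroup as soon as powers of it with coprime exponents do. -/
theorem mem_of_forall_pow_mem {G : Type*} [Group G] (H : Subgroup G) {N : ℕ} (hN : N ≠ 0) {a : G}
    (h : a ^ N ∈ H) (hp : ∀ ℓ : ℕ, ℓ.Prime → ℓ ∣ N → ∃ M : ℕ, ¬ ℓ ∣ M ∧ a ^ M ∈ H) : a ∈ H := by
  classical
  -- By Bézout the admissible exponents are closed under gcd, so the least positive one divides all
  -- of them; a prime factor of it would contradict `hp`.
  have hgcd : ∀ m n : ℕ, a ^ m ∈ H → a ^ n ∈ H → a ^ m.gcd n ∈ H := by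
    intro m n hm hn
    rw [← zpow_natCast, Nat.gcd_eq_gcd_ab, zpow_add, zpow_mul, zpow_mul, zpow_natCast, zpow_natCast]
    exact mul_mem (zpow_mem hm _) (zpow_mem hn _)
  have hex : ∃ d : ℕ, d ≠ 0 ∧ a ^ d ∈ H := ⟨N, hN, h⟩
  obtain ⟨hd0, hd⟩ := Nat.find_spec hex
  set d := Nat.find hex
  have hdvd : ∀ m, a ^ m ∈ H → d ∣ m := by
    intro m hm
    have h1 : d ≤ d.gcd m := Nat.find_min' hex ⟨Nat.gcd_ne_zero_left hd0, hgcd d m hd hm⟩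
    rw [← Nat.le_antisymm (Nat.gcd_le_left m (Nat.pos_of_ne_zero hd0)) h1]
    exact Nat.gcd_dvd_right d m
  by_cases hd1 : d = 1
  · rwa [hd1, pow_one] at hd
  · obtain ⟨ℓ, hℓ, hℓd⟩ := Nat.exists_prime_and_dvd hd1
    obtain ⟨M, hM, haM⟩ := hp ℓ hℓ (hℓd.trans (hdvd N h))
    exact absurd (hℓd.trans (hdvd M haM)) hM

/-- Realizing each primary component as a multiple `c • α` lets both inclusions be checked prime by
prime; only the passage back from powers to the element uses all primes together. -/
theorem rostKernel_eq_suslinGroup {N : ℕ} (hN : 0 < N)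
    (hF : ∀ ℓ n : ℕ, ℓ.Prime → 1 ≤ n → ℓ ^ n ∣ N → RostPowDivisible F ℓ n) {α : Br F}
    (hα : N • α = 0) : rostKernel α = (suslinGroup α : Set Fˣ) := by
  have hpart : ∀ ℓ : ℕ, ℓ.Prime → ∃ c M : ℕ, M ≠ 0 ∧ ¬ ℓ ∣ M ∧ IsPrimaryPart ℓ α (c • α) ∧
      M • (α - c • α) = 0 ∧ ∃ k, ℓ ^ k • c • α = 0 ∧
      primaryRostKernel ℓ (c • α) = primarySuslinGroup ℓ k (c • α) := by
    intro ℓ hℓ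
    obtain ⟨n, M, hM, rfl⟩ := Nat.exists_eq_pow_mul_and_not_dvd hN.ne' ℓ hℓ.ne_one
    obtain ⟨c, hc, hc1, hc2⟩ :=
      exists_isPrimaryPart ((Nat.Prime.coprime_iff_not_dvd hℓ).2 hM).symm hα
    refine ⟨c, M, by rintro rfl; simp at hM, hM, hc, hc2, ?_⟩
    -- The hypothesis concerns the exact period `ℓᵏ` of the component, which may be smaller than
    -- `ℓⁿ`.
    obtain ⟨k, hkn, hk⟩ := (Nat.dvd_prime_pow hℓ).1 (addOrderOf_dvd_of_nsmul_eq_zero hc1)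
    refine ⟨k, by rw [← hk]; exact addOrderOf_nsmul_eq_zero _, ?_⟩
    -- If `ℓ` does not divide `N`, the component is zero and both groups are all of `Fˣ`.
    rcases Nat.eq_zero_or_pos n with rfl | hn
    · obtain rfl : k = 0 := by omega
      rw [pow_zero, one_smul] at hc1
      rw [hc1, primaryRostKernel_zero]
      symm
      rw [Set.eq_univ_iff_forall]
      intro a
      refine Subgroup.subset_closure ?_
      exact ⟨0, le_rfl, a, by rw [smul_zero, nrd_zero]; trivial, by simp⟩
    · exact hF ℓ n hℓ hn (dvd_mul_right _ _) _ k hkn hk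
  ext a
  constructor
  · intro ha
    -- The exponent `N` works for every `a`, since the class `N • α` is zero.
    refine mem_of_forall_pow_mem (suslinGroup α) hN.ne' (Subgroup.subset_closure
      ⟨N, hN, a, by rw [hα, nrd_zero]; trivial, rfl⟩) fun ℓ hℓ _ => ?_
    obtain ⟨c, M, hM0, hM, hc, hMc, k, hk, hR⟩ := hpart ℓ hℓ
    obtain ⟨β, hβ, haβ⟩ := ha ℓ hℓ
    rw [hβ.eq hc, hR] at haβ
    exact ⟨M, hM, pow_mem_suslinGroup hℓ.pos (Nat.pos_of_ne_zero hM0) hMc haβ⟩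
  · intro ha ℓ hℓ
    obtain ⟨c, M, hM0, hM, hc, hMc, k, hk, hR⟩ := hpart ℓ hℓ
    refine ⟨c • α, hc, ?_⟩
    rw [hR]
    exact suslinGroup_le_primarySuslinGroup hℓ hk ha

end Br

theorem proposition3p4 (F : Type u) [Field F] :
    (∀ N : ℕ, 0 < N →
      (∀ ℓ n : ℕ, ℓ.Prime → 1 ≤ n → ℓ ^ n ∣ N → RostPowDivisible F ℓ n) →
      ∀ α : Br F, N • α = 0 → Br.rostKernel α = (Br.suslinGroup α : Set Fˣ)) ∧
    (RostDivisible F →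
      ∀ α : Br F, Br.rostKernel α = (Br.suslinGroup α : Set Fˣ)) := by
  refine ⟨fun N hN hF α hα => Br.rostKernel_eq_suslinGroup hN hF hα, fun hF α => ?_⟩
  obtain ⟨N, hN, hα⟩ := Br.exists_nsmul_eq_zero α
  exact Br.rostKernel_eq_suslinGroup hN (fun ℓ n hℓ hn _ => hF ℓ hℓ n hn) hα
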